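/- Let $\Sigma=\{1,2,3\}$, let $\Sigma^n$ be the set of words of length $n$, $\Sigma^*=\bigcup_{n\ge 0}\Sigma^n$ (with empty word $\vartheta$), and $\Sigma^\infty=\Sigma^{\mathbb N}$ with the product topology; for $\mathbf x\in\Sigma^\infty$ let $\mathbf x|_n$ be its prefix of length $n$. Let $q_1=(1/2,\sqrt3/2)$, $q_2=(0,0)$, $q_3=(1,0)$ and $S_i(x)=\tfrac12(x+q_i)$ on $\mathbb R^2$. The Sierpiński gasket $\mathcal K$ is the unique non-empty compact set with $\mathcal K=S_1(\mathcal K)\cup S_2(\mathcal K)\cup S_3(\mathcal K)$. Let $\pi(i_1i_2\ldots)=\lim_n S_{i_1}\circ\cdots\circ S_{i_n}(x_0)$ (independent of $x_0\in\mathbb R^2$), and write $\mathbf x\sim_\pi\mathbf y$ if $\pi(\mathbf x)=\pi(\mathbf y)$. Let $p\in(0,1/2)$ and let $(X_n)_{n\ge0}$ be the Markov chain on $\Sigma^*$ with the following transitions. From a word $i^n$ with $n\ge 0$, $i\in\Sigma$ (in particular from $\vartheta$), it moves to $i^nk$ with probability $1/3$ for each $k\in\Sigma$. Any other word is uniquely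 of the form $\omega i j^{m+1}$ with $\omega\in\Sigma^*$, $i\ne j$ in $\Sigma$, $m\ge0$; with $l$ the third letter, from it the chain moves to $\omega j i^{m+1}$ with probability $p$, to $\omega i j^{m} i$ with probability $p$, and to $\omega i j^{m} l$ with probability $1-2p$. Let $\rho_{x,y}=\mathbb P(\exists k\ge 0: X_k=y\mid X_0=x)$, $K(x,y)=\rho_{x,y}/\rho_{\vartheta,y}$ and $C_x=1/\rho_{\vartheta,x}$ for $x,y\in\Sigma^*$, and for a fixed $r\in(0,1)$ let $$\varrho(x,y)=\bigl|r^{|x|}-r^{|y|}\bigr|+\sum_{n=0}^\infty r^n\sup_{z\in\Sigma^n}C_z^{-1}\,|K(z,x)-K(z,y)|$$ be the Martin metric on $\Sigma^*$. The Martin space $\overline{\Sigma^*}$ is the completion of $(\Sigma^*,\varrho)$, and the Martin boundary is $\mathcal M=\overline{\Sigma^*}\setminus\Sigma^*$. **Theorem.** For every $p\in(0,1/2)$ and $r\in(0,1)$, the Martin boundary $\mathcal M$ of $(X_n)$ is homeomorphic to the Sierpiński gasket $\mathcal K$. More precisely: 1. For all $\mathbf x,\mathbf y\in\Sigma^\infty$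 the limit $\varrho(\mathbf x,\mathbf y):=\lim_{n}\varrho(\mathbf x|_n,\mathbf y|_n)$ exists in $[0,\infty)$, and it induces a well-defined metric on $\Sigma^\infty/{\sim_\pi}$; in particular $\varrho(\mathbf x,\mathbf y)>0$ whenever $\mathbf x\not\sim_\pi\mathbf y$. The topology of this metric is the quotient topology. 2. For each $\mathbf x\in\Sigma^\infty$ the sequence $(\mathbf x|_n)$ converges in $\overline{\Sigma^*}$ to a point of $\mathcal M$, and sending the class of $\mathbf x$ to this limit gives a homeomorphism $\Psi:\Sigma^\infty/{\sim_\pi}\to\mathcal M$. 3. There is a homeomorphism $\Phi:\mathcal M\to\mathcal K$ with $\Phi(\Psi([\mathbf x]))=\pi(\mathbf x)$ for all $\mathbf x\in\Sigma^\infty$. -/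

import Mathlib

open Set Filter Topology MeasureTheory ProbabilityTheory
open scoped ENNReal NNReal

namespace MartinSG

noncomputable section

/-! ### Words -/

/-- Finite words over the three-letter alphabet; the letters `1, 2, 3` are `0, 1, 2 : Fin 3`. -/
abbrev Word : Type := List (Fin 3)

/-- Infinite words, with the product topology. -/
abbrev InfWord : Type := ℕ → Fin 3

/-- The finite word consisting of the first `n` letters of `x`. -/
def InfWord.pre (x : InfWord) (n : ℕ) : Word := (List.range n).map x

instance : MeasurableSpace Word := ⊤

instance : DiscreteMeasurableSpace Word := ⟨fun _ => trivial⟩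

/-! ### The Sierpiński gasket and the standard projection -/

/-- The Euclidean plane. -/
abbrev Plane : Type := EuclideanSpace ℝ (Fin 2)

/-- The three corners of the unit triangle. -/
def corner : Fin 3 → Plane
  | 0 => !₂[1 / 2, Real.sqrt 3 / 2]
  | 1 => !₂[0, 0]
  | 2 => !₂[1, 0]

/-- The contraction `S_i(x) = (x + q_i) / 2`. -/
def contr (i : Fin 3) (x : Plane) : Plane := (1 / 2 : ℝ) • (x + corner i)

/-- The composition `S_{i_1} ∘ ⋯ ∘ S_{i_n}` along a word `i_1 ⋯ i_n`. -/
def contrWord : Word → Plane → Plane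
  | [] => id
  | i :: w => contr i ∘ contrWord w

/-- A non-empty compact set that is the union of its images under the three contractions. -/
def IsAttractor (K : Set Plane) : Prop :=
  IsCompact K ∧ K.Nonempty ∧ K = ⋃ i, contr i '' K

lemma edist_contr (i : Fin 3) (x y : Plane) :
    edist (contr i x) (contr i y) = ((1 / 2 : ℝ≥0) : ℝ≥0∞) * edist x y := by
  have h : nndist (contr i x) (contr i y) = (1 / 2 : ℝ≥0) * nndist x y := by
    apply NNReal.coe_injective
    simp [contr, dist_smul₀]
  rw [edist_nndist, edist_nndist, h, ENNReal.coe_mul]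

lemma continuous_contr (i : Fin 3) : Continuous (contr i) := by
  unfold contr; fun_prop

/-- The Hutchinson operator on non-empty compact sets. -/
def hutchinson (K : TopologicalSpace.NonemptyCompacts Plane) :
    TopologicalSpace.NonemptyCompacts Plane :=
  ⟨⟨⋃ i, contr i '' K, isCompact_iUnion fun i => K.isCompact.image (continuous_contr i)⟩,
    (K.nonempty.image (contr 0)).mono (subset_iUnion (fun i => contr i '' (K : Set Plane)) 0)⟩

lemma contracting_hutchinson : ContractingWith (1 / 2 : ℝ≥0) hutchinson := by
  have key : ∀ A B : TopologicalSpace.NonemptyCompacts Plane,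
      ∀ x ∈ (⋃ i, contr i '' (A : Set Plane)), ∃ y ∈ (⋃ i, contr i '' (B : Set Plane)),
        edist x y ≤ ((1 / 2 : ℝ≥0) : ℝ≥0∞) * Metric.hausdorffEDist (A : Set Plane) B := by
    intro A B x hx
    obtain ⟨i, a, ha, rfl⟩ := mem_iUnion.1 hx
    obtain ⟨b, hb, hab⟩ := B.isCompact.exists_infEDist_eq_edist B.nonempty a
    refine ⟨contr i b, mem_iUnion.2 ⟨i, b, hb, rfl⟩, ?_⟩
    rw [edist_contr, ← hab]
    gcongr
    exact Metric.infEDist_le_hausdorffEDist_of_mem ha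
  refine ⟨by rw [← NNReal.coe_lt_coe]; norm_num, fun A B => ?_⟩
  refine Metric.hausdorffEDist_le_of_mem_edist (key A B) fun x hx => ?_
  have := key B A x hx
  rwa [Metric.hausdorffEDist_comm] at this

theorem existsUnique_attractor : ∃! K : Set Plane, IsAttractor K := by
  have : Nonempty (TopologicalSpace.NonemptyCompacts Plane) := ⟨{0}⟩
  have hfix := contracting_hutchinson.fixedPoint_isFixedPt
  refine ⟨(ContractingWith.fixedPoint hutchinson contracting_hutchinson :
      TopologicalSpace.NonemptyCompacts Plane),
    ⟨TopologicalSpace.NonemptyCompacts.isCompact _, TopologicalSpace.NonemptyCompacts.nonempty _,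
      (congrArg (fun K : TopologicalSpace.NonemptyCompacts Plane => (K : Set Plane)) hfix).symm⟩,
    ?_⟩
  rintro K ⟨hc, hn, hK⟩
  have : Function.IsFixedPt hutchinson ⟨⟨K, hc⟩, hn⟩ := SetLike.coe_injective hK.symm
  exact congrArg (fun K : TopologicalSpace.NonemptyCompacts Plane => (K : Set Plane))
    (contracting_hutchinson.fixedPoint_unique this)

/-- The Sierpiński gasket: the unique non-empty compact set `K` with
`K = S_1(K) ∪ S_2(K) ∪ S_3(K)`. -/
def gasket : Set Plane := existsUnique_attractor.choose

/-- The standard projection `π(i_1 i_2 ⋯) = lim_n (S_{i_1} ∘ ⋯ ∘ S_{i_n})(x₀)`, with the base point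
`x₀ = 0`; the limit exists and does not depend on the base point, see `tendsto_proj`. -/
def proj (x : InfWord) : Plane := limUnder atTop fun n => contrWord (x.pre n) 0

lemma contrWord_append (v w : Word) : contrWord (v ++ w) = contrWord v ∘ contrWord w := by
  induction v with
  | nil => rfl
  | cons i v ih => simp [contrWord, ih, Function.comp_assoc]

lemma dist_contrWord (w : Word) (a b : Plane) :
    dist (contrWord w a) (contrWord w b) = (1 / 2) ^ w.length * dist a b := by
  induction w with
  | nil => simp [contrWord]
  | cons i w ih =>
    have : ∀ c d : Plane, dist (contr i c) (contr i d) = (1 / 2) * dist c d := by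
      intro c d; simp [contr, dist_smul₀]
    simp only [contrWord, Function.comp_apply, this, ih, List.length_cons, pow_succ]
    ring

theorem tendsto_proj (x : InfWord) (x₀ : Plane) :
    Tendsto (fun n => contrWord (x.pre n) x₀) atTop (𝓝 (proj x)) := by
  have hlen : ∀ n, (x.pre n).length = n := fun n => by simp [InfWord.pre]
  have h0 : Tendsto (fun n => contrWord (x.pre n) 0) atTop (𝓝 (proj x)) := by
    refine CauchySeq.tendsto_limUnder ?_
    obtain ⟨C, hC⟩ : ∃ C, ∀ i : Fin 3, dist (0 : Plane) (contr i 0) ≤ C :=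
      (Set.finite_range fun i : Fin 3 => dist (0 : Plane) (contr i 0)).bddAbove.imp
        fun C hC i => hC ⟨i, rfl⟩
    refine cauchySeq_of_le_geometric (1 / 2) C (by norm_num) fun n => ?_
    have : x.pre (n + 1) = x.pre n ++ [x n] := by simp [InfWord.pre, List.range_succ]
    rw [this, contrWord_append, Function.comp_apply, dist_contrWord, hlen, mul_comm]
    gcongr
    simpa [contrWord] using hC (x n)
  refine (tendsto_iff_of_dist ?_).1 h0
  simp only [dist_contrWord, hlen]
  simpa using (tendsto_pow_atTop_nhds_zero_of_lt_one (r := (1 / 2 : ℝ)) (by norm_num)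
    (by norm_num)).mul_const (dist (0 : Plane) x₀)

/-- `π`-equivalence of infinite words. -/
def piSetoid : Setoid InfWord := Setoid.ker proj

/-! ### The Markov chain -/

/-- The transition matrix. A word that is not a power of one letter is `ω i j^{m+1}` with `i ≠ j`,
in exactly one way; from there the chain moves to each of the words `ω j i^{m+1}` and `ω i j^m i`
with probability `p`, and to `ω i j^m l`, with `l` the third letter, with probability `1 - 2p`.
From a power `i^n` of one letter (for `n = 0`, the empty word) it appends a uniform letter. -/
def P (p : ℝ) (u v : Word) : ℝ :=
  open Classical in
  if ∃ (ω : Word) (i j : Fin 3) (m : ℕ), i ≠ j ∧ u = ω ++ i :: List.replicate (m + 1) j ∧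
      (v = ω ++ j :: List.replicate (m + 1) i ∨ v = ω ++ i :: (List.replicate m j ++ [i])) then p
  else if ∃ (ω : Word) (i j l : Fin 3) (m : ℕ), i ≠ j ∧ i ≠ l ∧ j ≠ l ∧
      u = ω ++ i :: List.replicate (m + 1) j ∧ v = ω ++ i :: (List.replicate m j ++ [l]) then
    1 - 2 * p
  else if ∃ (i : Fin 3) (n : ℕ) (k : Fin 3), u = List.replicate n i ∧ v = u ++ [k] then 1 / 3
  else 0

lemma decomp_exists (u : Word) : (∃ (i : Fin 3) (n : ℕ), u = List.replicate n i) ∨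
    ∃ (ω : Word) (i j : Fin 3) (m : ℕ), i ≠ j ∧ u = ω ++ i :: List.replicate (m + 1) j := by
  induction u using List.reverseRecOn with
  | nil => exact Or.inl ⟨0, 0, rfl⟩
  | append_singleton w a ih =>
    rcases ih with ⟨i, n, rfl⟩ | ⟨ω, i, j, m, hij, rfl⟩
    · by_cases h : i = a
      · exact Or.inl ⟨i, n + 1, by rw [List.replicate_succ', h]⟩
      · cases n with
        | zero => exact Or.inl ⟨a, 1, rfl⟩
        | succ n =>
          exact Or.inr ⟨List.replicate n i, i, a, 0, h, by simp [List.replicate_succ']⟩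
    · by_cases h : j = a
      · subst h
        exact Or.inr ⟨ω, i, j, m + 1, hij, by rw [List.replicate_succ' (n := m + 1)]; simp⟩
      · exact Or.inr ⟨ω ++ i :: List.replicate m j, j, a, 0, h, by simp [List.replicate_succ']⟩

lemma decomp_aux {i j i' j' : Fin 3} (hij : i ≠ j) (hij' : i' ≠ j') :
    ∀ (m m' : ℕ) (a a' : Word), List.replicate (m + 1) j ++ i :: a =
      List.replicate (m' + 1) j' ++ i' :: a' → m = m' ∧ j = j' ∧ i = i' ∧ a = a' := by
  intro m
  induction m with
  | zero =>
    intro m' a a' h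
    cases m' with
    | zero => simpa [List.replicate_succ] using h
    | succ m' =>
      simp only [List.replicate_succ, List.cons_append, List.cons.injEq, List.replicate_zero,
        List.nil_append] at h
      exact absurd (h.2.1.trans h.1.symm) hij
  | succ m ih =>
    intro m' a a' h
    cases m' with
    | zero =>
      rw [List.replicate_succ] at h
      simp only [List.replicate_succ, List.cons_append, List.cons.injEq, List.replicate_zero,
        List.nil_append] at h
      exact absurd (h.2.1.symm.trans h.1) hij'
    | succ m' =>
      rw [List.replicate_succ, List.replicate_succ (n := m' + 1)] at h
      simp only [List.cons_append, List.cons.injEq] at h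
      have := ih m' a a' h.2
      exact ⟨by rw [this.1], this.2⟩

lemma decomp_unique {i j i' j' : Fin 3} {m m' : ℕ} {ω ω' : Word} (hij : i ≠ j) (hij' : i' ≠ j')
    (h : ω ++ i :: List.replicate (m + 1) j = ω' ++ i' :: List.replicate (m' + 1) j') :
    ω = ω' ∧ i = i' ∧ j = j' ∧ m = m' := by
  have h' := congrArg List.reverse h
  simp only [List.reverse_append, List.reverse_cons, List.reverse_replicate,
    List.append_assoc, List.singleton_append] at h'
  obtain ⟨h1, h2, h3, h4⟩ := decomp_aux hij hij' m m' _ _ h'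
  exact ⟨List.reverse_injective h4, h3, h2, h1⟩

lemma not_replicate {i j k : Fin 3} {m n : ℕ} {ω : Word} (hij : i ≠ j)
    (h : ω ++ i :: List.replicate (m + 1) j = List.replicate n k) : False := by
  have hi : i = k := List.eq_of_mem_replicate (h ▸ by simp : i ∈ List.replicate n k)
  have hj : j = k := List.eq_of_mem_replicate (h ▸ by simp : j ∈ List.replicate n k)
  exact hij (hi.trans hj.symm)

lemma third_letter : ∀ i j l l' : Fin 3, i ≠ j → i ≠ l → j ≠ l → i ≠ l' → j ≠ l' → l = l' := by
  decide

/-- The rows of the transition matrix sum to `1`. -/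
theorem tsum_P {p : ℝ} (hp : p ∈ Ioo (0 : ℝ) (1 / 2)) (u : Word) :
    ∑' v, ENNReal.ofReal (P p u v) = 1 := by
  classical
  rcases decomp_exists u with ⟨i, n, rfl⟩ | ⟨ω, i, j, m, hij, rfl⟩
  · have hP : ∀ v, P p (List.replicate n i) v =
        if ∃ k : Fin 3, v = List.replicate n i ++ [k] then 1 / 3 else 0 := by
      intro v
      rw [P, if_neg, if_neg]
      · refine if_congr ⟨?_, ?_⟩ rfl rfl
        · rintro ⟨-, -, k, -, rfl⟩; exact ⟨k, rfl⟩
        · rintro ⟨k, rfl⟩; exact ⟨i, n, k, rfl, rfl⟩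
      · rintro ⟨_, _, _, _, _, h, -, -, h', -⟩; exact not_replicate h h'.symm
      · rintro ⟨_, _, _, _, h, h', -⟩; exact not_replicate h h'.symm
    have hinj : Function.Injective fun k : Fin 3 => List.replicate n i ++ [k] := by
      intro a b h; simpa using h
    rw [tsum_eq_sum (s := Finset.univ.map ⟨_, hinj⟩)]
    · rw [Finset.sum_map]
      simp only [hP, Function.Embedding.coeFn_mk]
      rw [Finset.sum_congr rfl (g := fun _ => ENNReal.ofReal (1 / 3))
        (fun k _ => by rw [if_pos ⟨k, rfl⟩])]
      rw [← ENNReal.ofReal_sum_of_nonneg (fun _ _ => by norm_num)]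
      norm_num
    · intro v hv
      rw [hP, if_neg, ENNReal.ofReal_zero]
      rintro ⟨k, rfl⟩
      exact hv (by simp)
  · obtain ⟨l, hil, hjl⟩ : ∃ l : Fin 3, i ≠ l ∧ j ≠ l := by
      revert i j; decide
    set v₁ : Word := ω ++ j :: List.replicate (m + 1) i with hv₁
    set v₂ : Word := ω ++ i :: (List.replicate m j ++ [i]) with hv₂
    set v₃ : Word := ω ++ i :: (List.replicate m j ++ [l]) with hv₃
    have h12 : v₁ ≠ v₂ := by
      intro h; simp only [hv₁, hv₂, List.append_cancel_left_eq, List.cons.injEq] at h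
      exact hij h.1.symm
    have h13 : v₁ ≠ v₃ := by
      intro h; simp only [hv₁, hv₃, List.append_cancel_left_eq, List.cons.injEq] at h
      exact hij h.1.symm
    have h23 : v₂ ≠ v₃ := by
      intro h; simp [hv₂, hv₃] at h; exact hil h
    have hP : ∀ v, P p (ω ++ i :: List.replicate (m + 1) j) v =
        if v = v₁ ∨ v = v₂ then p else if v = v₃ then 1 - 2 * p else 0 := by
      intro v
      rw [P]
      refine if_congr ⟨?_, fun h => ⟨ω, i, j, m, hij, rfl, h⟩⟩ rfl
        (if_congr ⟨?_, fun h => ⟨ω, i, j, l, m, hij, hil, hjl, rfl, h⟩⟩ rfl (if_neg ?_))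
      · rintro ⟨ω', i', j', m', h, h', hv⟩
        obtain ⟨rfl, rfl, rfl, rfl⟩ := decomp_unique hij h h'
        exact hv
      · rintro ⟨ω', i', j', l', m', h, hl, hl', h', hv⟩
        obtain ⟨rfl, rfl, rfl, rfl⟩ := decomp_unique hij h h'
        rw [hv, third_letter _ _ _ _ hij hl hl' hil hjl]
      · rintro ⟨k, n, -, h, -⟩; exact not_replicate hij h
    rw [tsum_eq_sum (s := {v₁, v₂, v₃})]
    · rw [Finset.sum_insert (by simp [h12, h13]), Finset.sum_pair h23]
      simp only [hP, true_or, or_true, if_true, h13.symm, h23.symm, or_self, if_false]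
      rw [← ENNReal.ofReal_add hp.1.le (by linarith [hp.2]),
        ← ENNReal.ofReal_add hp.1.le (by linarith [hp.1, hp.2])]
      norm_num
      ring
    · intro v hv
      simp only [Finset.mem_insert, Finset.mem_singleton, not_or] at hv
      rw [hP, if_neg (by tauto), if_neg hv.2.2, ENNReal.ofReal_zero]

/-- The row `P(u, ·)` as a probability mass function. -/
def stepPMF (p : ℝ) (hp : p ∈ Ioo (0 : ℝ) (1 / 2)) (u : Word) : PMF Word :=
  ⟨fun v => ENNReal.ofReal (P p u v), ENNReal.summable.hasSum_iff.2 (tsum_P hp u)⟩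

/-- The Markov kernel given by the transition matrix. -/
def stepKernel (p : ℝ) (hp : p ∈ Ioo (0 : ℝ) (1 / 2)) : Kernel Word Word :=
  Kernel.ofFunOfCountable fun u => (stepPMF p hp u).toMeasure

instance (p : ℝ) (hp : p ∈ Ioo (0 : ℝ) (1 / 2)) : IsMarkovKernel (stepKernel p hp) :=
  ⟨fun u => inferInstanceAs (IsProbabilityMeasure (stepPMF p hp u).toMeasure)⟩

/-- The conditional law of `X_{n+1}` given the history `(X_0, …, X_n)`: it is `P(X_n, ·)`. -/
def nextKernel (p : ℝ) (hp : p ∈ Ioo (0 : ℝ) (1 / 2)) (n : ℕ) :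
    Kernel (Π _ : Finset.Iic n, Word) Word :=
  (stepKernel p hp).comap (fun h => h ⟨n, Finset.mem_Iic.2 le_rfl⟩) (measurable_pi_apply _)

instance (p : ℝ) (hp : p ∈ Ioo (0 : ℝ) (1 / 2)) (n : ℕ) : IsMarkovKernel (nextKernel p hp n) := by
  unfold nextKernel; infer_instance

/-- The law of the trajectory `(X_n)` of the Markov chain with transition matrix `P` started
at `x`, a probability measure on the space of all sequences of words (Ionescu-Tulcea). -/
def chainLaw (p : ℝ) (hp : p ∈ Ioo (0 : ℝ) (1 / 2)) (x : Word) : Measure (ℕ → Word) :=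
  Kernel.traj (X := fun _ => Word) (nextKernel p hp) 0 fun _ => x

/-- The probability of ever visiting `y` (at a time `k ≥ 0`) when starting at `x`. -/
def hitProb (p : ℝ) (hp : p ∈ Ioo (0 : ℝ) (1 / 2)) (x y : Word) : ℝ :=
  (chainLaw p hp x).real {X | ∃ k, X k = y}

/-! ### Martin kernel, Martin metric, Martin boundary -/

/-- The Martin kernel `K(x, y) = ρ_{x,y} / ρ_{ϑ,y}`, where `ϑ` is the empty word. -/
def martinKernel (p : ℝ) (hp : p ∈ Ioo (0 : ℝ) (1 / 2)) (x y : Word) : ℝ :=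
  hitProb p hp x y / hitProb p hp [] y

/-- The constant `C_x = 1 / ρ_{ϑ,x}`. -/
def martinConst (p : ℝ) (hp : p ∈ Ioo (0 : ℝ) (1 / 2)) (x : Word) : ℝ :=
  1 / hitProb p hp [] x

/-- The Martin metric
`ϱ(x, y) = |r^{|x|} - r^{|y|}| + ∑_n r^n sup_{z ∈ Σ^n} C_z⁻¹ |K(z, x) - K(z, y)|`,
where supremum and sum are taken in `[0, ∞]`. -/
def martinDist (p : ℝ) (hp : p ∈ Ioo (0 : ℝ) (1 / 2)) (r : ℝ) (x y : Word) : ℝ≥0∞ :=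
  ENNReal.ofReal |r ^ x.length - r ^ y.length| +
    ∑' n : ℕ, ENNReal.ofReal (r ^ n) * ⨆ (z : Word) (_ : z.length = n),
      ENNReal.ofReal ((martinConst p hp z)⁻¹ * |martinKernel p hp z x - martinKernel p hp z y|)

/-- The set of finite words, equipped with the Martin metric. -/
def MartinWord (p : ℝ) (_ : p ∈ Ioo (0 : ℝ) (1 / 2)) (_ : ℝ) : Type := Word

instance (p : ℝ) (hp : p ∈ Ioo (0 : ℝ) (1 / 2)) (r : ℝ) :
    PseudoEMetricSpace (MartinWord p hp r) where
  edist x y := martinDist p hp r x y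
  edist_self x := by simp [martinDist]
  edist_comm x y := by simp only [martinDist, abs_sub_comm]
  edist_triangle x y z := by
    have tri : ∀ a b c : ℝ, ENNReal.ofReal |a - c| ≤
        ENNReal.ofReal |a - b| + ENNReal.ofReal |b - c| := fun a b c => by
      rw [← ENNReal.ofReal_add (abs_nonneg _) (abs_nonneg _)]
      exact ENNReal.ofReal_le_ofReal (abs_sub_le a b c)
    change martinDist p hp r x z ≤ martinDist p hp r x y + martinDist p hp r y z
    unfold martinDist
    rw [add_add_add_comm, ← ENNReal.tsum_add]
    refine add_le_add (tri _ _ _) (ENNReal.tsum_le_tsum fun n => ?_)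
    rw [← mul_add]
    gcongr
    refine iSup₂_le fun w hw => ?_
    refine le_trans ?_ (add_le_add (le_iSup₂ w hw) (le_iSup₂ w hw))
    have hC : 0 ≤ (martinConst p hp w)⁻¹ := by
      unfold martinConst hitProb; positivity
    simp only [ENNReal.ofReal_mul hC]
    rw [← mul_add]
    gcongr
    exact tri _ _ _

/-- The Martin space: the completion of the set of finite words for the Martin metric, that is,
the space of Cauchy sequences modulo distance zero. -/
abbrev MartinSpace (p : ℝ) (hp : p ∈ Ioo (0 : ℝ) (1 / 2)) (r : ℝ) : Type :=
  UniformSpace.Completion (MartinWord p hp r)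

/-- A finite word as a point of the Martin space. -/
def toMartin (p : ℝ) (hp : p ∈ Ioo (0 : ℝ) (1 / 2)) (r : ℝ) (w : Word) : MartinSpace p hp r :=
  ((show MartinWord p hp r from w : MartinWord p hp r) : UniformSpace.Completion _)

/-- The Martin boundary: the points of the Martin space that are not finite words. -/
def martinBoundary (p : ℝ) (hp : p ∈ Ioo (0 : ℝ) (1 / 2)) (r : ℝ) : Set (MartinSpace p hp r) :=
  (range (toMartin p hp r))ᶜ

end

end MartinSG

open MartinSG

/-!
The chain preserves the length of a word until it reaches a power `i ⋯ i` of one letter, a *corner*,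
from where it moves to the next length. A visit to a long word `y` of length `n + 1` therefore
depends on the starting point only through the corner of level `n` from which the last level was
entered, and the Martin kernel `K(z, y)` is an affine function of the conditional law of that corner
given that `y` is visited. Seen from level `m`, this law is moved towards the uniform law by the
factor `lam`, and the product of these factors has a positive limit (`lamLim_one_pos`).

As a function of `y`, the unnormalized law of the exit corner is the Green function, a solution
of the adjoint equation `g = g P` on words of given length (`AdjHarmonic`). By duality with the
harmonic hitting probabilities (`sum_mul_harmOp`) it is enough to study such solutions. The chain
watched at the words that end in `k + 1` equal letters, the corners of the cells of size `k + 1`, is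
again of the same type: the six inner corners of a cell can be eliminated (`InnerEq.outer`), which
replaces the odds `dpar` of moving inside a cell and the asymmetry `tpar` by explicit new values
(`AdjHarmonic.at`). On large scales the odds tend to `0` and the asymmetry to the symmetric value
`1 / 2`, so that in the limit the adjoint solutions obey the harmonic extension rule
`2/5, 2/5, 1/5` of the Sierpiński gasket, whatever `p` is (`tendsto_green`). A minimum principle
inside cells (`AdjHarmonic.nonneg`) carries this over from the corners of a cell to all its words.
The conditional law of the exit corner thus converges to the harmonic coordinates `harmCode` of the
point that the word approaches (`exists_exit_close`), and the Martin kernel to a positive multiple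
of them plus a constant at the words `z` of length one.

Harmonic coordinates and barycentric coordinates make the same identifications of infinite words,
because both come from three maps of a triangle whose images meet in the same pattern
(`IsGasketSystem.code_eq_iff`). Hence two infinite words have the same limit in the Martin space if
and only if they have the same image in the gasket (`martinLim_eq_iff`). Since infinite words form a
compact space and every boundary point is a limit of prefixes (`exists_martinLim_eq`), the quotient
is homeomorphic to the boundary as well as to the gasket.
-/

open MartinSG

namespace MartinSG

noncomputable section

/-! ### Hitting probabilities of the chain -/

section

/-- The probability, started at `x`, of visiting `y` no later than at time `N`, defined by
first-step recursion in `N`. -/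
def hitBefore (p : ℝ) (y : Word) : ℕ → Word → ℝ≥0∞
  | 0, x => if x = y then 1 else 0
  | N + 1, x => if x = y then 1 else ∑' v, ENNReal.ofReal (P p x v) * hitBefore p y N v

lemma hitBefore_self (p : ℝ) (y : Word) (N : ℕ) : hitBefore p y N y = 1 := by
  cases N <;> simp [hitBefore]

lemma lintegral_stepKernel {p : ℝ} (hp : p ∈ Ioo (0 : ℝ) (1 / 2)) (u : Word)
    (f : Word → ℝ≥0∞) :
    ∫⁻ v, f v ∂(stepKernel p hp u) = ∑' v, ENNReal.ofReal (P p u v) * f v := by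
  have h : stepKernel p hp u = (stepPMF p hp u).toMeasure := rfl
  rw [h, lintegral_countable']
  refine tsum_congr fun v => ?_
  rw [PMF.toMeasure_apply_singleton _ _ (measurableSet_singleton v), mul_comm]
  rfl

/-- The Markov property at time `m`. -/
lemma lintegral_chainLaw_succ {p : ℝ} (hp : p ∈ Ioo (0 : ℝ) (1 / 2)) (x : Word) (m : ℕ)
    (F : (Π _ : Finset.Iic m, Word) → Word → ℝ≥0∞) :
    ∫⁻ X, F (Preorder.frestrictLe (π := fun _ => Word) m X) (X (m + 1)) ∂(chainLaw p hp x) =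
      ∫⁻ X, ∑' v, ENNReal.ofReal (P p (X m) v) *
        F (Preorder.frestrictLe (π := fun _ => Word) m X) v ∂(chainLaw p hp x) := by
  have hF : Measurable (Function.uncurry F) := measurable_of_countable _
  have key := Kernel.partialTraj_compProd_eq_map_traj (X := fun _ => Word)
    (κ := nextKernel p hp) (Nat.zero_le m) (x₀ := fun _ => x)
  have h1 : ∫⁻ X, F (Preorder.frestrictLe (π := fun _ => Word) m X) (X (m + 1))
      ∂(chainLaw p hp x) = ∫⁻ q, Function.uncurry F q ∂((Kernel.traj (X := fun _ => Word)
        (nextKernel p hp) 0 fun _ => x).map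
          (fun X ↦ (Preorder.frestrictLe (π := fun _ => Word) m X, X (m + 1)))) := by
    rw [lintegral_map hF (by fun_prop)]
    rfl
  rw [h1, ← key, Measure.lintegral_compProd hF, ← Kernel.traj_map_frestrictLe_apply,
    lintegral_map (measurable_of_countable _) (by fun_prop)]
  refine lintegral_congr fun X => ?_
  exact lintegral_stepKernel hp _ _

lemma chainLaw_start {p : ℝ} (hp : p ∈ Ioo (0 : ℝ) (1 / 2)) (x : Word) (f : Word → ℝ≥0∞) :
    ∫⁻ X, f (X 0) ∂(chainLaw p hp x) = f x := by
  unfold chainLaw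
  rw [Kernel.lintegral_traj (X := fun _ => Word) (f := fun X => f (X 0)) _
    ((measurable_of_countable f).comp (measurable_pi_apply 0))]
  simp [Function.updateFinset]

lemma measurableSet_hitLe (y : Word) (N : ℕ) :
    MeasurableSet {X : ℕ → Word | ∃ k ≤ N, X k = y} := by
  have : {X : ℕ → Word | ∃ k ≤ N, X k = y} = ⋃ k, ⋃ (_ : k ≤ N), {X | X k = y} := by
    ext; simp
  rw [this]
  exact MeasurableSet.iUnion fun k => MeasurableSet.iUnion fun _ =>
    measurableSet_eq_fun (measurable_pi_apply k) measurable_const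

open Classical in
/-- Conditioning on the path up to time `m`: when `y` was not visited before time `m`, the
remaining probability is `hitBefore` from the position at time `m`. -/
lemma lintegral_hit_shift {p : ℝ} (hp : p ∈ Ioo (0 : ℝ) (1 / 2)) (x y : Word) (m j : ℕ) :
    ∫⁻ X, (if ∃ k < m, X k = y then 1 else hitBefore p y (j + 1) (X m)) ∂(chainLaw p hp x) =
      ∫⁻ X, (if ∃ k < m + 1, X k = y then 1 else hitBefore p y j (X (m + 1)))
        ∂(chainLaw p hp x) := by
  have h := lintegral_chainLaw_succ hp x m
    (fun h v => if ∃ k : Finset.Iic m, h k = y then 1 else hitBefore p y j v)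
  have e : ∀ X : ℕ → Word, (∃ k : Finset.Iic m, Preorder.frestrictLe (π := fun _ => Word) m X k = y)
      ↔ ∃ k < m + 1, X k = y := by
    intro X
    constructor
    · rintro ⟨⟨k, hk⟩, h⟩; exact ⟨k, Nat.lt_succ_of_le (Finset.mem_Iic.1 hk), h⟩
    · rintro ⟨k, hk, h⟩; exact ⟨⟨k, Finset.mem_Iic.2 (Nat.le_of_lt_succ hk)⟩, h⟩
  simp only [e] at h
  rw [h]
  refine lintegral_congr fun X => ?_
  by_cases h1 : ∃ k < m, X k = y
  · have h2 : ∃ k < m + 1, X k = y := by obtain ⟨k, hk, h⟩ := h1; exact ⟨k, by omega, h⟩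
    simp only [if_pos h1, if_pos h2, mul_one, tsum_P hp]
  · rw [if_neg h1]
    by_cases h3 : X m = y
    · have h2 : ∃ k < m + 1, X k = y := ⟨m, by omega, h3⟩
      simp only [if_pos h2, mul_one, tsum_P hp]
      simp [h3, hitBefore]
    · have h2 : ¬ ∃ k < m + 1, X k = y := by
        rintro ⟨k, hk, h'⟩
        rcases Nat.lt_succ_iff_lt_or_eq.1 hk with h4 | rfl
        · exact h1 ⟨k, h4, h'⟩
        · exact h3 h'
      simp only [if_neg h2]
      simp [hitBefore, h3]

lemma chainLaw_hitLe {p : ℝ} (hp : p ∈ Ioo (0 : ℝ) (1 / 2)) (x y : Word) (N : ℕ) :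
    chainLaw p hp x {X | ∃ k ≤ N, X k = y} = hitBefore p y N x := by
  classical
  have h : ∀ j m, ∫⁻ X, (if ∃ k < m, X k = y then 1 else hitBefore p y j (X m))
      ∂(chainLaw p hp x) = hitBefore p y (m + j) x := by
    intro j m
    induction m generalizing j with
    | zero => simpa using chainLaw_start hp x _
    | succ m ih => rw [← lintegral_hit_shift, ih]; congr 1; omega
  rw [← Nat.add_zero N, ← h 0 N, Nat.add_zero, ← lintegral_indicator_one (measurableSet_hitLe y N)]
  refine lintegral_congr fun X => ?_
  by_cases h1 : ∃ k < N, X k = y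
  · have h2 : ∃ k ≤ N, X k = y := by obtain ⟨k, hk, h⟩ := h1; exact ⟨k, hk.le, h⟩
    simp [indicator, h1, h2]
  · by_cases h3 : X N = y
    · have h2 : ∃ k ≤ N, X k = y := ⟨N, le_rfl, h3⟩
      simp [indicator, h1, h2, hitBefore, h3]
    · have h2 : ¬ ∃ k ≤ N, X k = y := by
        rintro ⟨k, hk, h⟩
        rcases hk.lt_or_eq with h4 | rfl
        · exact h1 ⟨k, h4, h⟩
        · exact h3 h
      simp [indicator, h1, h2, hitBefore, h3]

lemma monotone_hitBefore {p : ℝ} (hp : p ∈ Ioo (0 : ℝ) (1 / 2)) (x y : Word) :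
    Monotone fun N => hitBefore p y N x := by
  intro M N h
  simp only [← chainLaw_hitLe hp]
  refine measure_mono ?_
  rintro X ⟨k, hk, h'⟩
  exact ⟨k, hk.trans h, h'⟩

lemma chainLaw_hit {p : ℝ} (hp : p ∈ Ioo (0 : ℝ) (1 / 2)) (x y : Word) :
    chainLaw p hp x {X | ∃ k, X k = y} = ⨆ N, hitBefore p y N x := by
  have : {X : ℕ → Word | ∃ k, X k = y} = ⋃ N, {X | ∃ k ≤ N, X k = y} := by
    ext X
    simp only [mem_ofPred_eq, mem_iUnion]
    exact ⟨fun ⟨k, h⟩ => ⟨k, k, le_rfl, h⟩, fun ⟨_, k, _, h⟩ => ⟨k, h⟩⟩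
  rw [this, Directed.measure_iUnion]
  · simp only [chainLaw_hitLe]
  · refine Monotone.directed_le fun M N h X => ?_
    rintro ⟨k, hk, h'⟩
    exact ⟨k, hk.trans h, h'⟩

instance (p : ℝ) (hp : p ∈ Ioo (0 : ℝ) (1 / 2)) (x : Word) :
    IsProbabilityMeasure (chainLaw p hp x) := by
  unfold chainLaw; infer_instance

variable {p : ℝ} (hp : p ∈ Ioo (0 : ℝ) (1 / 2))

lemma hitProb_nonneg (x y : Word) : 0 ≤ hitProb p hp x y := measureReal_nonneg

lemma hitProb_le_one (x y : Word) : hitProb p hp x y ≤ 1 := measureReal_le_one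

lemma ofReal_hitProb (x y : Word) :
    ENNReal.ofReal (hitProb p hp x y) = ⨆ N, hitBefore p y N x := by
  rw [← chainLaw_hit hp, hitProb, ofReal_measureReal]

lemma hitProb_self (x : Word) : hitProb p hp x x = 1 := by
  have h := ofReal_hitProb hp x x
  simp only [hitBefore_self, ciSup_const] at h
  simpa using h

lemma ofReal_hitProb_step {x y : Word} (hxy : x ≠ y) :
    ENNReal.ofReal (hitProb p hp x y) =
      ∑' v, ENNReal.ofReal (P p x v) * ENNReal.ofReal (hitProb p hp v y) := by
  have h : ∀ N, hitBefore p y (N + 1) x = ∫⁻ v, hitBefore p y N v ∂(stepKernel p hp x) := by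
    intro N
    rw [lintegral_stepKernel, hitBefore, if_neg hxy]
  rw [ofReal_hitProb, ← (monotone_hitBefore hp x y).iSup_nat_add 1]
  simp only [h]
  rw [← lintegral_iSup (fun N => measurable_of_countable _)
    (fun M N h v => monotone_hitBefore hp v y h), lintegral_stepKernel]
  simp only [ofReal_hitProb]

/-- First-step analysis along any finite set of words that supports the transition row. -/
lemma hitProb_step {x y : Word} (hxy : x ≠ y) (s : Finset Word) (hs : ∀ v ∉ s, P p x v = 0)
    (hP : ∀ v, 0 ≤ P p x v) :
    hitProb p hp x y = ∑ v ∈ s, P p x v * hitProb p hp v y := by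
  have h := ofReal_hitProb_step hp hxy
  rw [tsum_eq_sum (s := s) (fun v hv => by simp [hs v hv])] at h
  simp only [← ENNReal.ofReal_mul (hP _)] at h
  have h0 : ∀ v ∈ s, 0 ≤ P p x v * hitProb p hp v y :=
    fun v _ => mul_nonneg (hP v) (hitProb_nonneg hp v y)
  rw [← ENNReal.ofReal_sum_of_nonneg h0] at h
  exact (ENNReal.ofReal_eq_ofReal_iff (hitProb_nonneg hp x y) (Finset.sum_nonneg h0)).1 h

lemma hitBefore_mul_le (v z x : Word) (N : ℕ) :
    hitBefore p z N v * ENNReal.ofReal (hitProb p hp z x) ≤ ENNReal.ofReal (hitProb p hp v x) := by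
  induction N generalizing v with
  | zero =>
    by_cases h : v = z
    · simp [hitBefore, h]
    · simp [hitBefore, h]
  | succ N ih =>
    by_cases h : v = z
    · simp [hitBefore, h]
    · by_cases hx : v = x
      · subst hx
        rw [hitProb_self, ENNReal.ofReal_one]
        refine mul_le_one' ?_ (ENNReal.ofReal_le_one.2 (hitProb_le_one hp _ _))
        rw [← chainLaw_hitLe hp]
        exact prob_le_one
      · rw [ofReal_hitProb_step hp hx, hitBefore, if_neg h, ← ENNReal.tsum_mul_right]
        refine ENNReal.tsum_le_tsum fun u => ?_
        rw [mul_assoc]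
        gcongr
        exact ih u

/-- Visiting `z` and then `x` is one way of visiting `x`. -/
lemma hitProb_mul_le (v z x : Word) :
    hitProb p hp v z * hitProb p hp z x ≤ hitProb p hp v x := by
  have h : ENNReal.ofReal (hitProb p hp v z) * ENNReal.ofReal (hitProb p hp z x) ≤
      ENNReal.ofReal (hitProb p hp v x) := by
    rw [ofReal_hitProb hp v z, ENNReal.iSup_mul]
    exact iSup_le fun N => hitBefore_mul_le hp v z x N
  rw [← ENNReal.ofReal_mul (hitProb_nonneg hp _ _)] at h
  exact (ENNReal.ofReal_le_ofReal_iff (hitProb_nonneg hp _ _)).1 h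

lemma hitProb_eq_zero_of_invariant {y : Word} (S : Set Word) (hy : y ∉ S)
    (hS : ∀ u ∈ S, ∀ v, P p u v ≠ 0 → v ∈ S) {x : Word} (hx : x ∈ S) :
    hitProb p hp x y = 0 := by
  have h : ∀ N, ∀ u ∈ S, hitBefore p y N u = 0 := by
    intro N
    induction N with
    | zero => intro u hu; rw [hitBefore, if_neg (by rintro rfl; exact hy hu)]
    | succ N ih =>
      intro u hu
      rw [hitBefore, if_neg (by rintro rfl; exact hy hu), ENNReal.tsum_eq_zero]
      intro v
      by_cases hv : P p u v = 0
      · simp [hv]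
      · simp [ih v (hS u hu v hv)]
  have := ofReal_hitProb hp x y
  simp only [h _ x hx, ciSup_const, ENNReal.ofReal_eq_zero] at this
  exact le_antisymm this (hitProb_nonneg hp x y)

end

/-! ### Combinatorics of words -/

section

/-- The power `b ⋯ b` (`k` letters). -/
abbrev rep (k : ℕ) (b : Fin 3) : Word := List.replicate k b

/-- The last letter of `w` that differs from `b`, if there is one. -/
def prv (b : Fin 3) (w : Word) : Option (Fin 3) := w.reverse.find? (fun c => c ≠ b)

lemma prv_nil (b : Fin 3) : prv b [] = none := rfl

lemma prv_append_self (b : Fin 3) (w : Word) : prv b (w ++ [b]) = prv b w := by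
  simp [prv]

lemma prv_append_of_ne {a b : Fin 3} (h : a ≠ b) (w : Word) : prv b (w ++ [a]) = some a := by
  simp [prv, h]

lemma prv_eq_some {a b : Fin 3} {w : Word} (h : prv b w = some a) :
    a ≠ b ∧ ∃ ω m, w = ω ++ a :: rep m b := by
  induction w using List.reverseRecOn with
  | nil => simp [prv_nil] at h
  | append_singleton w c ih =>
    by_cases hc : c = b
    · subst hc
      rw [prv_append_self] at h
      obtain ⟨h1, ω, m, rfl⟩ := ih h
      exact ⟨h1, ω, m + 1, by simp [rep, List.replicate_succ']⟩
    · rw [prv_append_of_ne hc] at h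
      obtain rfl : c = a := by simpa using h
      exact ⟨hc, w, 0, rfl⟩

lemma prv_eq_none {b : Fin 3} {w : Word} : prv b w = none ↔ w = rep w.length b := by
  simp [prv, List.find?_eq_none, List.mem_reverse, List.eq_replicate_iff]

/-- The conjugate word: `ω i j^{m+1}` and `ω j i^{m+1}` with `i ≠ j` are conjugate to each other,
and powers of one letter are their own conjugates. -/
def conj (w : Word) : Word :=
  open Classical in
  if h : ∃ (q : Word × Fin 3 × Fin 3 × ℕ), q.2.1 ≠ q.2.2.1 ∧
      w = q.1 ++ q.2.1 :: rep (q.2.2.2 + 1) q.2.2.1 then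
    h.choose.1 ++ h.choose.2.2.1 :: rep (h.choose.2.2.2 + 1) h.choose.2.1
  else w

lemma conj_append {i j : Fin 3} (hij : i ≠ j) (ω : Word) (m : ℕ) :
    conj (ω ++ i :: rep (m + 1) j) = ω ++ j :: rep (m + 1) i := by
  have h : ∃ (q : Word × Fin 3 × Fin 3 × ℕ), q.2.1 ≠ q.2.2.1 ∧
      ω ++ i :: rep (m + 1) j = q.1 ++ q.2.1 :: rep (q.2.2.2 + 1) q.2.2.1 :=
    ⟨(ω, i, j, m), hij, rfl⟩
  rw [conj, dif_pos h]
  obtain ⟨h1, h2, h3, h4⟩ := decomp_unique hij h.choose_spec.1 h.choose_spec.2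
  rw [← h1, ← h2, ← h3, ← h4]

lemma conj_rep (n : ℕ) (i : Fin 3) : conj (rep n i) = rep n i := by
  rw [conj, dif_neg]
  rintro ⟨q, h1, h2⟩
  exact not_replicate h1 h2.symm

lemma conj_conj (w : Word) : conj (conj w) = w := by
  rcases decomp_exists w with ⟨i, n, rfl⟩ | ⟨ω, i, j, m, hij, rfl⟩
  · rw [conj_rep, conj_rep]
  · rw [conj_append hij, conj_append hij.symm]

lemma length_conj (w : Word) : (conj w).length = w.length := by
  rcases decomp_exists w with ⟨i, n, rfl⟩ | ⟨ω, i, j, m, hij, rfl⟩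
  · rw [conj_rep]
  · rw [conj_append hij]; simp

lemma conj_inner {a b : Fin 3} (hab : a ≠ b) (w : Word) {k : ℕ} (hk : 1 ≤ k) :
    conj (w ++ [a] ++ rep k b) = w ++ [b] ++ rep k a := by
  obtain ⟨k, rfl⟩ := Nat.exists_eq_add_of_le' hk
  simpa using conj_append hab w k

lemma rep_succ_append (w : Word) (k : ℕ) (a : Fin 3) :
    w ++ [a] ++ rep k a = w ++ rep (k + 1) a := by
  simp [rep, List.replicate_succ]

/-- The weight with which a walk that leaves the corner `b` into the cell `w` moves to the
corner `a`. The corner `b` of the whole gasket (`w` a power of `b`) distributes evenly; at any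
other corner the last letter `i ≠ b` of `w` receives `1 - t` and the third letter `t`. -/
def tau (t : ℝ) (w : Word) (b a : Fin 3) : ℝ :=
  if a = b then 0 else
    match prv b w with
    | none => 1 / 2
    | some i => if a = i then 1 - t else t

lemma tau_self (t : ℝ) (w : Word) (b : Fin 3) : tau t w b b = 0 := by simp [tau]

lemma tau_add (t : ℝ) (w : Word) {b a c : Fin 3} (hab : a ≠ b) (hcb : c ≠ b) (hac : a ≠ c) :
    tau t w b a + tau t w b c = 1 := by
  unfold tau
  rw [if_neg hab, if_neg hcb]
  rcases h : prv b w with _ | i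
  · norm_num
  · have hib := (prv_eq_some h).1
    dsimp only
    by_cases h1 : a = i
    · rw [if_pos h1, if_neg (fun h2 => hac (h1.trans h2.symm))]; ring
    · have : c = i := third_letter a b c i hab hac hcb.symm h1 hib.symm
      rw [if_neg h1, if_pos this]; ring

lemma tau_pos {t : ℝ} (h0 : 0 < t) (h1 : t < 1) (w : Word) {b a : Fin 3} (hab : a ≠ b) :
    0 < tau t w b a := by
  unfold tau
  rw [if_neg hab]
  split
  · norm_num
  · split_ifs <;> linarith

/-- Weights in a subcell `w a`, from its corner `a`. -/
lemma tau_append_self (t : ℝ) (w : Word) (a b : Fin 3) :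
    tau t (w ++ [a]) a b = tau t w a b := by
  unfold tau; rw [prv_append_self]

/-- Weights in a subcell `w a`, from a corner other than `a`. -/
lemma tau_append_of_ne (t : ℝ) (w : Word) {a b c : Fin 3} (hba : b ≠ a) (hcb : c ≠ b) :
    tau t (w ++ [a]) b c = if c = a then 1 - t else t := by
  unfold tau; rw [prv_append_of_ne hba.symm, if_neg hcb]

lemma tau_nil (t : ℝ) {b a : Fin 3} (hab : a ≠ b) : tau t [] b a = 1 / 2 := by
  simp [tau, hab, prv_nil]

/-- How the weights of a cell arise from those of its subcells. -/
lemma tau_next {t t' : ℝ} (ht : t' * (1 + t) = t * (2 - t)) (w : Word) {b a c : Fin 3}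
    (hab : a ≠ b) (hcb : c ≠ b) (hac : a ≠ c) :
    tau t' w b a * (1 + t) = tau t w b a + t * tau t w b c := by
  unfold tau
  rw [if_neg hab, if_neg hcb, if_neg hab]
  rcases h : prv b w with _ | i
  · dsimp only; ring
  · have hib := (prv_eq_some h).1
    dsimp only
    by_cases h1 : a = i
    · rw [if_pos h1, if_pos h1, if_neg (fun h2 => hac (h1.trans h2.symm))]
      linear_combination -ht
    · have : c = i := third_letter a b c i hab hac hcb.symm h1 hib.symm
      rw [if_neg h1, if_neg h1, if_pos this]; linear_combination ht

lemma tendsto_tau {t : ℕ → ℝ} (ht : Tendsto t atTop (𝓝 (1 / 2))) (w : Word) {b a : Fin 3}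
    (hab : a ≠ b) : Tendsto (fun k => tau (t k) w b a) atTop (𝓝 (1 / 2)) := by
  unfold tau
  simp only [if_neg hab]
  rcases h : prv b w with _ | i
  · exact tendsto_const_nhds
  · dsimp only
    split_ifs
    · convert ht.const_sub 1 using 2; norm_num
    · exact ht

lemma exists_third {a b : Fin 3} (h : a ≠ b) : ∃ c, c ≠ a ∧ c ≠ b := by
  revert a b; decide

lemma exists_others (a : Fin 3) : ∃ b c : Fin 3, a ≠ b ∧ a ≠ c ∧ b ≠ c := by
  revert a; decide

lemma sum_letters {a b c : Fin 3} (hab : a ≠ b) (hac : a ≠ c) (hbc : b ≠ c) (f : Fin 3 → ℝ) :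
    ∑ i, f i = f a + f b + f c := by
  have : (Finset.univ : Finset (Fin 3)) = {a, b, c} := by
    revert a b c; decide
  rw [this, Finset.sum_insert (by simp [hab, hac]), Finset.sum_pair hbc, add_assoc]

/-! ### Sums over words of given length -/

/-- The words of length `n`. -/
def wordsOf (n : ℕ) : Finset Word :=
  (Finset.univ : Finset (List.Vector (Fin 3) n)).image List.Vector.toList

@[simp] lemma mem_wordsOf {n : ℕ} {w : Word} : w ∈ wordsOf n ↔ w.length = n := by
  simp only [wordsOf, Finset.mem_image, Finset.mem_univ, true_and]
  exact ⟨fun ⟨a, ha⟩ => ha ▸ a.2, fun h => ⟨⟨w, h⟩, rfl⟩⟩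

lemma sum_wordsOf_succ (n : ℕ) (F : Word → ℝ) :
    ∑ x ∈ wordsOf (n + 1), F x = ∑ w ∈ wordsOf n, ∑ a, F (w ++ [a]) := by
  rw [← Finset.sum_product']
  symm
  refine Finset.sum_bij (fun q _ => q.1 ++ [q.2]) ?_ ?_ ?_ ?_
  · rintro ⟨w, a⟩ h
    simpa using h
  · rintro ⟨w, a⟩ - ⟨w', a'⟩ - h
    simpa using h
  · intro x hx
    rw [mem_wordsOf] at hx
    rcases List.eq_nil_or_concat x with rfl | ⟨w, a, rfl⟩
    · simp at hx
    · exact ⟨(w, a), by simpa using hx, by simp⟩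
  · intros; rfl

lemma sum_wordsOf_conj (n : ℕ) (F : Word → ℝ) :
    ∑ x ∈ wordsOf n, F (conj x) = ∑ x ∈ wordsOf n, F x :=
  Finset.sum_nbij' conj conj (by simp [length_conj]) (by simp [length_conj])
    (by simp [conj_conj]) (by simp [conj_conj]) (by simp)

/-! ### The transition matrix in terms of cells -/

lemma P_nonneg {p : ℝ} (hp : p ∈ Ioo (0 : ℝ) (1 / 2)) (u v : Word) : 0 ≤ P p u v := by
  have := hp.1; have := hp.2
  unfold P
  split_ifs <;> linarith

lemma P_rep (p : ℝ) (n : ℕ) (i : Fin 3) (v : Word) :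
    P p (rep n i) v = open Classical in if ∃ k : Fin 3, v = rep n i ++ [k] then 1 / 3 else 0 := by
  classical
  rw [P, if_neg, if_neg]
  · refine if_congr ⟨?_, ?_⟩ rfl rfl
    · rintro ⟨-, -, k, -, rfl⟩; exact ⟨k, rfl⟩
    · rintro ⟨k, rfl⟩; exact ⟨i, n, k, rfl, rfl⟩
  · rintro ⟨_, _, _, _, _, h, -, -, h', -⟩; exact not_replicate h h'.symm
  · rintro ⟨_, _, _, _, h, h', -⟩; exact not_replicate h h'.symm

lemma P_cell (p : ℝ) {w : Word} {i j l : Fin 3} (hij : i ≠ j) (hil : i ≠ l) (hjl : j ≠ l)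
    (h : prv j w = some i) (v : Word) :
    P p (w ++ [j]) v = open Classical in if v = conj (w ++ [j]) ∨ v = w ++ [i] then p
      else if v = w ++ [l] then 1 - 2 * p else 0 := by
  classical
  obtain ⟨-, ω, m, rfl⟩ := prv_eq_some h
  have e : ω ++ i :: rep m j ++ [j] = ω ++ i :: rep (m + 1) j := by
    simp [rep, List.replicate_succ']
  rw [e, conj_append hij, P]
  simp only [rep]
  refine if_congr ⟨?_, fun h => ⟨ω, i, j, m, hij, rfl, by simpa using h⟩⟩ rfl
    (if_congr ⟨?_, fun h => ⟨ω, i, j, l, m, hij, hil, hjl, rfl, by simpa using h⟩⟩ rfl (if_neg ?_))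
  · rintro ⟨ω', i', j', m', h, h', hv⟩
    obtain ⟨rfl, rfl, rfl, rfl⟩ := decomp_unique hij h h'
    simpa using hv
  · rintro ⟨ω', i', j', l', m', h, hl, hl', h', hv⟩
    obtain ⟨rfl, rfl, rfl, rfl⟩ := decomp_unique hij h h'
    rw [hv, third_letter _ _ _ _ hij hl hl' hil hjl]
    simp
  · rintro ⟨k, n, -, h, -⟩; exact not_replicate hij h

/-- The parameter of the weights `tau` at the smallest scale. -/
def t₁ (p : ℝ) : ℝ := (1 - 2 * p) / (1 - p)

lemma conj_cell_ne {w : Word} {i j : Fin 3} (h : prv j w = some i) (b : Fin 3) :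
    conj (w ++ [j]) ≠ w ++ [b] := by
  obtain ⟨hij, ω, m, rfl⟩ := prv_eq_some h
  have e : ω ++ i :: rep m j ++ [j] = ω ++ i :: rep (m + 1) j := by
    simp [rep, List.replicate_succ']
  rw [e, conj_append hij]
  intro h
  simp only [List.append_assoc, List.cons_append, List.append_cancel_left_eq, List.cons.injEq] at h
  exact hij h.1.symm

variable {p : ℝ} (hp : p ∈ Ioo (0 : ℝ) (1 / 2))

/-- First-step analysis at a word that is not a power of one letter. -/
lemma hitProb_cell {w y : Word} {j : Fin 3} (h : prv j w ≠ none) (hy : w ++ [j] ≠ y) :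
    hitProb p hp (w ++ [j]) y = p * hitProb p hp (conj (w ++ [j])) y +
      (1 - p) * ∑ b, tau (t₁ p) w j b * hitProb p hp (w ++ [b]) y := by
  classical
  obtain ⟨i, hi⟩ := Option.ne_none_iff_exists'.1 h
  have hij := (prv_eq_some hi).1
  obtain ⟨l, hli, hlj⟩ := exists_third hij
  have hP := P_cell p hij hli.symm hlj.symm hi
  have c1 := conj_cell_ne hi i
  have c2 := conj_cell_ne hi l
  have h23 : w ++ [i] ≠ w ++ [l] := by simpa using hli.symm
  rw [hitProb_step hp hy {conj (w ++ [j]), w ++ [i], w ++ [l]} _ (P_nonneg hp _)]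
  · rw [Finset.sum_insert (by simp [c1, c2]), Finset.sum_pair h23, hP, hP, hP,
      sum_letters hij hli.symm hlj.symm]
    simp only [true_or, or_true, if_true, c2.symm, h23.symm, or_self, if_false, tau, hi, hij, hlj,
      hli]
    have : 1 - p ≠ 0 := by have := hp.2; intro h; linarith
    unfold t₁
    field_simp
    ring
  · intro v hv
    simp only [Finset.mem_insert, Finset.mem_singleton, not_or] at hv
    rw [hP, if_neg (by tauto), if_neg hv.2.2]

/-- First-step analysis at a power of one letter. -/
lemma hitProb_corner {n : ℕ} {i : Fin 3} {y : Word} (hy : rep n i ≠ y) :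
    hitProb p hp (rep n i) y = 1 / 3 * ∑ k, hitProb p hp (rep n i ++ [k]) y := by
  classical
  have hinj : Function.Injective fun k : Fin 3 => rep n i ++ [k] := by
    intro a b h; simpa using h
  rw [hitProb_step hp hy (Finset.univ.map ⟨_, hinj⟩) _ (P_nonneg hp _)]
  · rw [Finset.sum_map, Finset.mul_sum]
    refine Finset.sum_congr rfl fun k _ => ?_
    rw [P_rep, Function.Embedding.coeFn_mk, if_pos ⟨k, rfl⟩]
  · intro v hv
    rw [P_rep, if_neg]
    rintro ⟨k, rfl⟩
    exact hv (by simp)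

lemma length_of_P_ne_zero {u v : Word} (h : P p u v ≠ 0) :
    v.length = u.length ∨ ((∃ n i, u = rep n i) ∧ v.length = u.length + 1) := by
  classical
  rcases decomp_exists u with ⟨i, n, rfl⟩ | ⟨ω, i, j, m, hij, rfl⟩
  · rw [P_rep] at h
    obtain ⟨k, rfl⟩ := by_contra fun h' => h (if_neg h')
    right; exact ⟨⟨n, i, rfl⟩, by simp⟩
  · obtain ⟨l, hli, hlj⟩ := exists_third hij
    left
    have e : ω ++ i :: List.replicate (m + 1) j = ω ++ i :: rep m j ++ [j] := by
      simp [rep, List.replicate_succ']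
    have hi : prv j (ω ++ i :: rep m j) = some i := by
      clear h e
      induction m with
      | zero => exact prv_append_of_ne hij ω
      | succ m ih =>
        have e' : ω ++ i :: rep (m + 1) j = ω ++ i :: rep m j ++ [j] := by
          simp [rep, List.replicate_succ']
        rw [e', prv_append_self, ih]
    rw [e, P_cell p hij hli.symm hlj.symm hi] at h
    rw [e]
    split_ifs at h with h1 h2
    · rcases h1 with rfl | rfl
      · rw [length_conj]
      · simp
    · subst h2; simp
    · exact absurd rfl h

/-- The chain never returns to shorter words. -/
lemma hitProb_of_length_lt {x y : Word} (h : y.length < x.length) : hitProb p hp x y = 0 := by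
  refine hitProb_eq_zero_of_invariant hp {u | y.length < u.length} (by simp) ?_ h
  intro u hu v hv
  have hu' : y.length < u.length := hu
  change y.length < v.length
  rcases length_of_P_ne_zero hv with h | ⟨-, h⟩ <;> omega

/-- From a power of one letter the chain moves on to longer words. -/
lemma hitProb_corner_of_length {n : ℕ} {i : Fin 3} {y : Word} (hy : rep n i ≠ y)
    (h : y.length ≤ n) : hitProb p hp (rep n i) y = 0 := by
  rw [hitProb_corner hp hy, Finset.sum_eq_zero, mul_zero]
  intro k _
  exact hitProb_of_length_lt hp (by simpa using Nat.lt_succ_of_le h)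

end

/-! ### Scale parameters -/

section

/-- The parameter of the weights `tau` for the chain watched at the corners of the cells of
size `k + 1`, that is, at the words ending in `k + 1` equal letters. -/
def tpar (p : ℝ) : ℕ → ℝ
  | 0 => t₁ p
  | k + 1 => tpar p k * (2 - tpar p k) / (1 + tpar p k)

/-- The odds of moving inside the current cell, against moving to the conjugate word, for the
chain watched at the corners of the cells of size `k + 1`. -/
def dpar (p : ℝ) : ℕ → ℝ
  | 0 => (1 - p) / p
  | k + 1 => dpar p k * (1 + tpar p k) / (2 + tpar p k + (1 - tpar p k) * (1 + tpar p k) * dpar p k)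

section

variable {p : ℝ} (hp : p ∈ Ioo (0 : ℝ) (1 / 2))
include hp

lemma tpar_mem (k : ℕ) : 0 < tpar p k ∧ tpar p k < 1 := by
  induction k with
  | zero =>
    have h1 : 0 < 1 - p := by linarith [hp.2]
    refine ⟨div_pos (by linarith [hp.2]) h1, ?_⟩
    rw [tpar, t₁, div_lt_one h1]; linarith [hp.1]
  | succ k ih =>
    obtain ⟨h0, h1⟩ := ih
    rw [tpar]
    refine ⟨div_pos (mul_pos h0 (by linarith)) (by linarith), ?_⟩
    rw [div_lt_one (by linarith)]
    nlinarith [sq_nonneg (tpar p k - 1 / 2)]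

lemma tpar_succ_mul (k : ℕ) : tpar p (k + 1) * (1 + tpar p k) = tpar p k * (2 - tpar p k) := by
  have := (tpar_mem hp k).1
  rw [tpar]; field_simp

lemma dpar_pos (k : ℕ) : 0 < dpar p k := by
  induction k with
  | zero => exact div_pos (by linarith [hp.2]) hp.1
  | succ k ih =>
    obtain ⟨h0, h1⟩ := tpar_mem hp k
    have : 0 < (1 - tpar p k) * (1 + tpar p k) * dpar p k := by
      have : 0 < 1 - tpar p k := by linarith
      positivity
    rw [dpar]; positivity

lemma dpar_succ_mul (k : ℕ) :
    dpar p (k + 1) * (2 + tpar p k + (1 - tpar p k) * (1 + tpar p k) * dpar p k) =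
      dpar p k * (1 + tpar p k) := by
  obtain ⟨h0, h1⟩ := tpar_mem hp k
  have : 0 < (1 - tpar p k) * (1 + tpar p k) * dpar p k := by
    have := dpar_pos hp k
    have : 0 < 1 - tpar p k := by linarith
    positivity
  rw [dpar]
  exact div_mul_cancel₀ _ (by linarith)

lemma dpar_succ_le (k : ℕ) : dpar p (k + 1) ≤ 2 / 3 * dpar p k := by
  obtain ⟨h0, h1⟩ := tpar_mem hp k
  have hd := dpar_pos hp k
  have h2 : 0 < (1 - tpar p k) * (1 + tpar p k) * dpar p k := by
    have : 0 < 1 - tpar p k := by linarith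
    positivity
  rw [dpar, div_le_iff₀ (by linarith)]
  nlinarith

lemma dpar_le (k : ℕ) : dpar p k ≤ (2 / 3) ^ k * dpar p 0 := by
  induction k with
  | zero => simp
  | succ k ih => rw [pow_succ]; linarith [dpar_succ_le hp k]

lemma tendsto_dpar : Tendsto (dpar p) atTop (𝓝 0) := by
  refine squeeze_zero (fun k => (dpar_pos hp k).le) (dpar_le hp) ?_
  simpa using (tendsto_pow_atTop_nhds_zero_of_lt_one (r := (2 / 3 : ℝ)) (by norm_num)
    (by norm_num)).mul_const (dpar p 0)

/-- The asymmetry of the walk disappears on large scales. -/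
lemma tendsto_tpar : Tendsto (tpar p) atTop (𝓝 (1 / 2)) := by
  set m := min (tpar p 0) (1 / 2) with hm
  have hm0 : 0 < m := lt_min (tpar_mem hp 0).1 (by norm_num)
  have hdiff : ∀ k, tpar p (k + 1) - 1 / 2 =
      (tpar p k - 1 / 2) * ((1 - tpar p k) / (1 + tpar p k)) := by
    intro k
    have := (tpar_mem hp k).1
    rw [tpar]; field_simp; ring
  have hlow : ∀ k, m ≤ tpar p k := by
    intro k
    induction k with
    | zero => exact min_le_left _ _
    | succ k ih =>
      obtain ⟨h0, h1⟩ := tpar_mem hp k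
      rcases le_total (tpar p k) (1 / 2) with h | h
      · refine ih.trans ?_
        rw [tpar, le_div_iff₀ (by linarith)]
        nlinarith
      · have h2 : 0 ≤ tpar p (k + 1) - 1 / 2 := by
          rw [hdiff]
          exact mul_nonneg (by linarith) (div_nonneg (by linarith) (by linarith))
        linarith [min_le_right (tpar p 0) (1 / 2)]
  have hq : ∀ k, |tpar p k - 1 / 2| ≤ (1 / (1 + m)) ^ k * |tpar p 0 - 1 / 2| := by
    intro k
    induction k with
    | zero => simp
    | succ k ih =>
      obtain ⟨h0, h1⟩ := tpar_mem hp k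
      have h2 : (1 - tpar p k) / (1 + tpar p k) ≤ 1 / (1 + m) := by
        have := hlow k
        gcongr
        linarith
      have h3 : 0 ≤ (1 - tpar p k) / (1 + tpar p k) :=
        div_nonneg (by linarith) (by linarith)
      rw [hdiff, abs_mul, abs_of_nonneg h3, pow_succ]
      calc _ ≤ ((1 / (1 + m)) ^ k * |tpar p 0 - 1 / 2|) * (1 / (1 + m)) := by gcongr
        _ = _ := by ring
  rw [tendsto_iff_dist_tendsto_zero]
  refine squeeze_zero (fun _ => dist_nonneg) (fun k => hq k) ?_
  have h1 : 1 / (1 + m) < 1 := by rw [div_lt_one] <;> linarith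
  simpa using (tendsto_pow_atTop_nhds_zero_of_lt_one (by positivity) h1).mul_const
    |tpar p 0 - 1 / 2|

end

/-! ### The adjoint equations inside one cell -/

section Cell

variable {G τ : Fin 3 → Fin 3 → ℝ} {d t : ℝ}

/-- The adjoint equations at the six inner corners `w a b ⋯ b` (`a ≠ b`) of a cell `w`, where
`G a b` is the value at `w a b ⋯ b`. -/
def InnerEq (d t : ℝ) (τ G : Fin 3 → Fin 3 → ℝ) : Prop :=
  ∀ a b c : Fin 3, a ≠ b → a ≠ c → b ≠ c →
    G a b - G b a = -d * (G a b - τ a b * G a a - t * G a c)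

lemma InnerEq.pair (h : InnerEq d t τ G) (hd : d ≠ 0) {a b c : Fin 3} (hab : a ≠ b) (hac : a ≠ c)
    (hbc : b ≠ c) :
    G a b + G b a = τ a b * G a a + τ b a * G b b + t * (G a c + G b c) := by
  have h1 := h a b c hab hac hbc
  have h2 := h b a c hab.symm hbc hac
  apply mul_left_cancel₀ hd
  linear_combination h1 + h2

lemma InnerEq.swap (h : InnerEq d t τ G) (hτ : ∀ a b c : Fin 3, a ≠ b → a ≠ c → b ≠ c →
    τ a b + τ a c = 1) {a b c : Fin 3} (hab : a ≠ b) (hac : a ≠ c) (hbc : b ≠ c) :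
    G b a + G c a = G a b + G a c - d * (G a a - (1 - t) * (G a b + G a c)) := by
  have h1 := h a b c hab hac hbc
  have h2 := h a c b hac hab hbc.symm
  have h3 := hτ a b c hab hac hbc
  linear_combination -h1 - h2 - d * G a a * h3

/-- Elimination of the inner corners of a cell. -/
lemma InnerEq.outer (h : InnerEq d t τ G) (hd : d ≠ 0)
    (hτ : ∀ a b c : Fin 3, a ≠ b → a ≠ c → b ≠ c → τ a b + τ a c = 1)
    {a b c : Fin 3} (hab : a ≠ b) (hac : a ≠ c) (hbc : b ≠ c) :
    (2 + t + (1 - t) * (1 + t) * d) * (G a a - (1 - t) * (G a b + G a c)) =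
      (1 + t) * G a a - ((τ b a + t * τ b c) * G b b + (τ c a + t * τ c b) * G c c) := by
  have h1 := h.swap hτ hab hac hbc
  have h2 := h.pair hd hab hac hbc
  have h3 := h.pair hd hac hab hbc.symm
  have h4 := h.pair hd hbc hab.symm hac.symm
  have h5 := hτ a b c hab hac hbc
  linear_combination (1 - t) * (1 + t) * h1 - h2 - h3 - t * h4 - G a a * h5

lemma InnerEq.exists_min (h : InnerEq d t τ G) :
    ∃ a b c : Fin 3, a ≠ b ∧ a ≠ c ∧ b ≠ c ∧ (∀ x y, x ≠ y → G a b ≤ G x y) ∧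
      (1 + d) * G a b = G b a + d * t * G a c + d * τ a b * G a a := by
  obtain ⟨⟨a, b⟩, hab, hmin⟩ := Finset.exists_min_image
    ((Finset.univ : Finset (Fin 3 × Fin 3)).filter fun q => q.1 ≠ q.2) (fun q => G q.1 q.2)
    ⟨(0, 1), by simp⟩
  simp only [Finset.mem_filter, Finset.mem_univ, true_and] at hab hmin
  obtain ⟨c, hca, hcb⟩ := exists_third hab
  refine ⟨a, b, c, hab, hca.symm, hcb.symm, fun x y hxy => hmin (x, y) hxy, ?_⟩
  linear_combination h a b c hab hca.symm hcb.symm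

lemma InnerEq.nonneg (h : InnerEq d t τ G) (hd : 0 < d) (ht : 0 < t ∧ t < 1)
    (hτ : ∀ a b, a ≠ b → 0 < τ a b) (hG : ∀ a, 0 ≤ G a a) (a b : Fin 3) : 0 ≤ G a b := by
  by_cases hab : a = b
  · exact hab ▸ hG a
  obtain ⟨x, y, z, hxy, hxz, hyz, hmin, e⟩ := h.exists_min
  refine le_trans ?_ (hmin a b hab)
  have h1 := hmin y x hxy.symm
  have h2 := mul_le_mul_of_nonneg_left (hmin x z hxz) (mul_pos hd ht.1).le
  have h3 := mul_nonneg (mul_pos hd (hτ x y hxy)).le (hG x)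
  have h4 : 0 ≤ (d * (1 - t)) * G x y := by linarith
  exact nonneg_of_mul_nonneg_right h4 (mul_pos hd (by linarith [ht.2]))

lemma InnerEq.pos (h : InnerEq d t τ G) (hd : 0 < d) (ht : 0 < t ∧ t < 1)
    (hτ : ∀ a b, a ≠ b → 0 < τ a b) (hG : ∀ a, 0 < G a a) (a b : Fin 3) : 0 < G a b := by
  by_cases hab : a = b
  · exact hab ▸ hG a
  obtain ⟨x, y, z, hxy, hxz, hyz, hmin, e⟩ := h.exists_min
  refine lt_of_lt_of_le ?_ (hmin a b hab)
  have h1 := hmin y x hxy.symm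
  have h2 := mul_le_mul_of_nonneg_left (hmin x z hxz) (mul_pos hd ht.1).le
  have h3 := mul_pos (mul_pos hd (hτ x y hxy)) (hG x)
  have h4 : 0 < (d * (1 - t)) * G x y := by linarith
  exact pos_of_mul_pos_right h4 (mul_pos hd (by linarith [ht.2])).le

end Cell

/-! ### The adjoint equations on all scales -/

/-- The adjoint of `id - P` on words of given length, at the word `w a`. The corners of the
gasket are treated like the other words, with the even weights of `tau` and with themselves as
their conjugates. -/
def adjOp (p : ℝ) (g : Word → ℝ) (w : Word) (a : Fin 3) : ℝ :=
  g (w ++ [a]) - p * g (conj (w ++ [a])) - (1 - p) * ∑ b, tau (t₁ p) w b a * g (w ++ [b])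

/-- `g` solves the adjoint equation at all words of length `n` that are not powers of one letter. -/
def AdjHarmonic (p : ℝ) (n : ℕ) (g : Word → ℝ) : Prop :=
  ∀ w a, w.length + 1 = n → prv a w ≠ none → adjOp p g w a = 0

/-- The weighted flow into the corner `a` of the cell `w` from its other corners, where `w` has
size `k + 1`. -/
def inflow (p : ℝ) (g : Word → ℝ) (k : ℕ) (w : Word) (a : Fin 3) : ℝ :=
  ∑ b, tau (tpar p k) w b a * g (w ++ rep (k + 1) b)

/-- `g` solves the adjoint equation of the chain watched at the corners of cells of size
`k + 1`. -/
def AdjHarmonicAt (p : ℝ) (n : ℕ) (g : Word → ℝ) (k : ℕ) : Prop :=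
  ∀ w a, w.length + (k + 1) = n → prv a w ≠ none →
    g (w ++ rep (k + 1) a) - g (conj (w ++ rep (k + 1) a)) =
      -dpar p k * (g (w ++ rep (k + 1) a) - inflow p g k w a)

lemma inflow_append_self (p : ℝ) (g : Word → ℝ) (k : ℕ) (w : Word) {a b c : Fin 3} (hab : a ≠ b)
    (hac : a ≠ c) (hbc : b ≠ c) :
    inflow p g k (w ++ [a]) a = (1 - tpar p k) *
      (g (w ++ [a] ++ rep (k + 1) b) + g (w ++ [a] ++ rep (k + 1) c)) := by
  rw [inflow, sum_letters hab hac hbc, tau_self, tau_append_of_ne _ _ hab.symm hab,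
    tau_append_of_ne _ _ hac.symm hac, if_pos rfl]
  ring

lemma inflow_append_of_ne (p : ℝ) (g : Word → ℝ) (k : ℕ) (w : Word) {a b c : Fin 3} (hab : a ≠ b)
    (hac : a ≠ c) (hbc : b ≠ c) :
    inflow p g k (w ++ [a]) b = tau (tpar p k) w a b * g (w ++ [a] ++ rep (k + 1) a) +
      tpar p k * g (w ++ [a] ++ rep (k + 1) c) := by
  rw [inflow, sum_letters hab hac hbc, tau_self, tau_append_self,
    tau_append_of_ne _ _ hac.symm hbc, if_neg hab.symm]
  ring

variable {p : ℝ} {n : ℕ} {g : Word → ℝ}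

lemma AdjHarmonicAt.innerEq {k : ℕ} (h : AdjHarmonicAt p n g k) {w : Word}
    (hw : w.length + (k + 2) = n) :
    InnerEq (dpar p k) (tpar p k) (tau (tpar p k) w) fun a b => g (w ++ [a] ++ rep (k + 1) b) := by
  intro a b c hab hac hbc
  have h1 := h (w ++ [a]) b (by simp; omega) (by simp [prv_append_of_ne hab])
  rw [inflow_append_of_ne p g k w hab hac hbc, conj_inner hab w (by omega)] at h1
  linear_combination h1

variable (hp : p ∈ Ioo (0 : ℝ) (1 / 2))
include hp

lemma AdjHarmonicAt.inflow_succ {k : ℕ} (h : AdjHarmonicAt p n g k) {w : Word}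
    (hw : w.length + (k + 2) = n) (a : Fin 3) :
    dpar p k * (g (w ++ rep (k + 2) a) - inflow p g k (w ++ [a]) a) =
      dpar p (k + 1) * (g (w ++ rep (k + 2) a) - inflow p g (k + 1) w a) := by
  obtain ⟨b, c, hab, hac, hbc⟩ := exists_others a
  obtain ⟨h0, h1⟩ := tpar_mem hp k
  have hI := (h.innerEq hw).outer (dpar_pos hp k).ne'
    (fun a b c hab hac hbc => tau_add _ w hab.symm hac.symm hbc) hab hac hbc
  simp only [rep_succ_append] at hI
  rw [inflow_append_self p g k w hab hac hbc, inflow, sum_letters hab hac hbc, tau_self]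
  have hd := dpar_succ_mul hp k
  have ht := tpar_succ_mul hp k
  have t1 := tau_next ht w hab hbc.symm hac
  have t2 := tau_next ht w hac hbc hab
  have hpos : (2 + tpar p k + (1 - tpar p k) * (1 + tpar p k) * dpar p k) ≠ 0 := by
    have := dpar_pos hp k
    have : 0 < (1 - tpar p k) := by linarith
    positivity
  apply mul_left_cancel₀ hpos
  rw [← t1, ← t2] at hI
  linear_combination dpar p k * hI - (g (w ++ rep (k + 2) a) -
    (tau (tpar p (k + 1)) w b a * g (w ++ rep (k + 2) b) +
      tau (tpar p (k + 1)) w c a * g (w ++ rep (k + 2) c))) * hd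

lemma AdjHarmonic.at_zero (h : AdjHarmonic p n g) : AdjHarmonicAt p n g 0 := by
  intro w a hw ha
  have h1 := h w a (by omega) ha
  have := hp.1
  simp only [adjOp] at h1
  simp only [inflow, dpar, tpar, zero_add, rep, List.replicate_one]
  field_simp
  linear_combination h1

lemma AdjHarmonic.at (h : AdjHarmonic p n g) (k : ℕ) : AdjHarmonicAt p n g k := by
  induction k with
  | zero => exact h.at_zero hp
  | succ k ih =>
    intro w a hw ha
    have h1 := ih.inflow_succ hp hw a
    have h2 := ih (w ++ [a]) a (by simp; omega) (by rwa [prv_append_self])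
    rw [rep_succ_append] at h2
    linear_combination h2 - h1

/-- The defect of the adjoint equation at a corner of the gasket is explicit. -/
lemma AdjHarmonic.corner (h : AdjHarmonic p n g) (hn : 2 ≤ n) (a : Fin 3) :
    adjOp p g (rep (n - 1) a) a = (1 - p) * (dpar p (n - 1) / dpar p 0) *
      (g (rep n a) - inflow p g (n - 1) [] a) := by
  have hk : ∀ k, k + 1 ≤ n → dpar p 0 * (g (rep n a) - inflow p g 0 (rep (n - 1) a) a) =
      dpar p k * (g (rep n a) - inflow p g k (rep (n - 1 - k) a) a) := by
    intro k hk
    induction k with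
    | zero => rfl
    | succ k ih =>
      rw [ih (by omega)]
      have h1 := (h.at hp k).inflow_succ hp (w := rep (n - 1 - (k + 1)) a) (by simp; omega) a
      have e1 : rep (n - 1 - (k + 1)) a ++ rep (k + 2) a = rep n a := by
        rw [← List.replicate_add]; congr 1; omega
      have e2 : rep (n - 1 - (k + 1)) a ++ [a] = rep (n - 1 - k) a := by
        rw [← List.replicate_succ']; congr 1; omega
      rwa [e1, e2] at h1
  have h1 := hk (n - 1) (by omega)
  have e1 : rep (n - 1) a ++ [a] = rep n a := by
    rw [← List.replicate_succ']; congr 1; omega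
  have e0 : rep 0 a = [] := rfl
  rw [Nat.sub_self, e0] at h1
  have hd := (dpar_pos hp 0).ne'
  rw [adjOp, e1, conj_rep]
  have e3 : inflow p g 0 (rep (n - 1) a) a =
      ∑ b, tau (t₁ p) (rep (n - 1) a) b a * g (rep (n - 1) a ++ [b]) := rfl
  rw [← e3]
  field_simp
  linear_combination (1 - p) * h1

lemma AdjHarmonic.nonneg (h : AdjHarmonic p n g) {w v : Word} (hn : (w ++ v).length = n)
    (hg : ∀ j, 0 ≤ g (w ++ rep v.length j)) : 0 ≤ g (w ++ v) := by
  induction v generalizing w with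
  | nil => simpa using hg 0
  | cons a v ih =>
    rw [← List.singleton_append, ← List.append_assoc]
    refine ih (by simpa using hn) fun j => ?_
    rcases Nat.eq_zero_or_pos v.length with h0 | h0
    · have := hg a
      rw [h0]
      simpa [h0] using this
    · obtain ⟨k, hk⟩ := Nat.exists_eq_add_of_le' h0
      rw [hk]
      refine ((h.at hp k).innerEq (w := w) ?_).nonneg (dpar_pos hp k) (tpar_mem hp k)
        (fun a b hab => tau_pos (tpar_mem hp k).1 (tpar_mem hp k).2 w hab.symm) (fun b => ?_) a j
      · simp at hn; omega
      · have := hg b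
        simp only [rep_succ_append]
        simpa [hk] using this

lemma AdjHarmonic.pos (h : AdjHarmonic p n g) {w v : Word} (hn : (w ++ v).length = n)
    (hg : ∀ j, 0 < g (w ++ rep v.length j)) : 0 < g (w ++ v) := by
  induction v generalizing w with
  | nil => simpa using hg 0
  | cons a v ih =>
    rw [← List.singleton_append, ← List.append_assoc]
    refine ih (by simpa using hn) fun j => ?_
    rcases Nat.eq_zero_or_pos v.length with h0 | h0
    · have := hg a
      rw [h0]
      simpa [h0] using this
    · obtain ⟨k, hk⟩ := Nat.exists_eq_add_of_le' h0
      rw [hk]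
      refine ((h.at hp k).innerEq (w := w) ?_).pos (dpar_pos hp k) (tpar_mem hp k)
        (fun a b hab => tau_pos (tpar_mem hp k).1 (tpar_mem hp k).2 w hab.symm) (fun b => ?_) a j
      · simp at hn; omega
      · have := hg b
        simp only [rep_succ_append]
        simpa [hk] using this

end

/-! ### Existence of adjoint solutions and duality with hitting probabilities -/

section

/-- The operator `id - P` on words of given length, at the word `w a`, with the same conventions
at the corners of the gasket as `adjOp`. -/
def harmOp (p : ℝ) (f : Word → ℝ) (w : Word) (a : Fin 3) : ℝ :=
  f (w ++ [a]) - p * f (conj (w ++ [a])) - (1 - p) * ∑ b, tau (t₁ p) w a b * f (w ++ [b])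

lemma sum_mul_harmOp (p : ℝ) (m : ℕ) (f g : Word → ℝ) :
    ∑ w ∈ wordsOf m, ∑ a, g (w ++ [a]) * harmOp p f w a =
      ∑ w ∈ wordsOf m, ∑ a, f (w ++ [a]) * adjOp p g w a := by
  have h1 : ∑ w ∈ wordsOf m, ∑ a, g (w ++ [a]) * f (conj (w ++ [a])) =
      ∑ w ∈ wordsOf m, ∑ a, f (w ++ [a]) * g (conj (w ++ [a])) := by
    rw [← sum_wordsOf_succ m fun x => g x * f (conj x),
      ← sum_wordsOf_succ m fun x => f x * g (conj x),
      ← sum_wordsOf_conj]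
    simp only [conj_conj, mul_comm]
  have h2 : ∀ w, ∑ a, g (w ++ [a]) * ∑ b, tau (t₁ p) w a b * f (w ++ [b]) =
      ∑ a, f (w ++ [a]) * ∑ b, tau (t₁ p) w b a * g (w ++ [b]) := by
    intro w
    simp only [Finset.mul_sum]
    rw [Finset.sum_comm]
    refine Finset.sum_congr rfl fun _ _ => Finset.sum_congr rfl fun _ _ => by ring
  have h3 : ∀ (F G : Word → ℝ) (A B : Word → Fin 3 → ℝ),
      ∑ w ∈ wordsOf m, ∑ a, F (w ++ [a]) * (G (w ++ [a]) - p * A w a - (1 - p) * B w a) =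
      (∑ w ∈ wordsOf m, ∑ a, F (w ++ [a]) * G (w ++ [a])) -
        p * (∑ w ∈ wordsOf m, ∑ a, F (w ++ [a]) * A w a) -
        (1 - p) * ∑ w ∈ wordsOf m, ∑ a, F (w ++ [a]) * B w a := by
    intro F G A B
    simp only [Finset.mul_sum, ← Finset.sum_sub_distrib]
    refine Finset.sum_congr rfl fun _ _ => Finset.sum_congr rfl fun _ _ => by ring
  simp only [harmOp, adjOp]
  rw [h3 g f (fun w a => f (conj (w ++ [a]))) (fun w a => ∑ b, tau (t₁ p) w a b * f (w ++ [b])),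
    h3 f g (fun w a => g (conj (w ++ [a]))) (fun w a => ∑ b, tau (t₁ p) w b a * g (w ++ [b])),
    h1, Finset.sum_congr rfl fun w _ => h2 w]
  congr 2
  refine Finset.sum_congr rfl fun _ _ => Finset.sum_congr rfl fun _ _ => mul_comm _ _

/-- A sum over words of length `m + 1` whose terms vanish off the corners of the gasket. -/
lemma sum_eq_corners (m : ℕ) (F : Word → Fin 3 → ℝ)
    (hF : ∀ w a, w.length = m → prv a w ≠ none → F w a = 0) :
    ∑ w ∈ wordsOf m, ∑ a, F w a = ∑ a, F (rep m a) a := by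
  rw [Finset.sum_comm]
  refine Finset.sum_congr rfl fun a _ => Finset.sum_eq_single _ ?_ ?_
  · intro w hw hne
    rw [mem_wordsOf] at hw
    exact hF w a hw fun h => hne (by rw [← hw]; exact prv_eq_none.1 h)
  · simp

lemma adjOp_lincomb (p α β : ℝ) (g h : Word → ℝ) (w : Word) (a : Fin 3) :
    adjOp p (fun x => α * g x + β * h x) w a = α * adjOp p g w a + β * adjOp p h w a := by
  simp only [adjOp, mul_add, Finset.sum_add_distrib, Finset.mul_sum, mul_sub]
  have : ∀ (c : ℝ) (k : Word → ℝ), ∑ i, (1 - p) * (tau (t₁ p) w i a * (c * k (w ++ [i]))) =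
      ∑ i, c * ((1 - p) * (tau (t₁ p) w i a * k (w ++ [i]))) :=
    fun c k => Finset.sum_congr rfl fun _ _ => by ring
  rw [this, this]
  ring

lemma AdjHarmonic.lincomb {p : ℝ} {n : ℕ} {g h : Word → ℝ} (hg : AdjHarmonic p n g)
    (hh : AdjHarmonic p n h) (α β : ℝ) : AdjHarmonic p n fun x => α * g x + β * h x := by
  intro w a hw ha
  rw [adjOp_lincomb, hg w a hw ha, hh w a hw ha]
  ring

lemma rep_succ' (n : ℕ) (a : Fin 3) : rep n a ++ [a] = rep (n + 1) a :=
  List.replicate_succ'.symm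

variable {p : ℝ} (hp : p ∈ Ioo (0 : ℝ) (1 / 2))
include hp

lemma AdjHarmonic.eq_zero {n : ℕ} {g : Word → ℝ} (h : AdjHarmonic p n g)
    (hg : ∀ j, g (rep n j) = 0) {x : Word} (hx : x.length = n) : g x = 0 := by
  have h1 := h.nonneg hp (w := []) (v := x) (by simpa using hx) (by simp [hx, hg])
  have h2 := (h.lincomb h (-1) 0).nonneg hp (w := []) (v := x) (by simpa using hx)
    (by simp [hx, hg])
  simp only [List.nil_append] at h1 h2
  linarith

/-- The adjoint problem is solvable: uniqueness gives existence in finite dimension. -/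
lemma exists_adj (m : ℕ) (φ : Word → ℝ) : ∃ g : Word → ℝ, ∀ w a, w.length = m →
    if prv a w = none then g (w ++ [a]) = φ (w ++ [a]) else adjOp p g w a = φ (w ++ [a]) := by
  classical
  let V := {x // x ∈ wordsOf (m + 1)} → ℝ
  let ext : V → Word → ℝ := fun g x => if h : x ∈ wordsOf (m + 1) then g ⟨x, h⟩ else 0
  have ext_lin : ∀ (α β : ℝ) (g h : V),
      ext (α • g + β • h) = fun x => α * ext g x + β * ext h x := by
    intro α β g h
    funext x
    by_cases hx : x ∈ wordsOf (m + 1)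
    · simp only [ext, dif_pos hx]; rfl
    · simp only [ext, dif_neg hx]; simp
  let T₀ : V → V := fun g x => if prv (x.1.getLastD 0) x.1.dropLast = none then ext g x.1
    else adjOp p (ext g) x.1.dropLast (x.1.getLastD 0)
  have T_lin : ∀ (α β : ℝ) (g h : V), T₀ (α • g + β • h) = α • T₀ g + β • T₀ h := by
    intro α β g h
    funext x
    change _ = α * T₀ g x + β * T₀ h x
    simp only [T₀, ext_lin]
    split_ifs
    · rfl
    · rw [adjOp_lincomb]
  let T : V →ₗ[ℝ] V :=
    { toFun := T₀
      map_add' := fun g h => by simpa using T_lin 1 1 g h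
      map_smul' := fun α g => by simpa using T_lin α 0 g 0 }
  have key : ∀ (g : V) (w : Word) (a : Fin 3) (hw : w ++ [a] ∈ wordsOf (m + 1)),
      T g ⟨w ++ [a], hw⟩ = if prv a w = none then ext g (w ++ [a]) else adjOp p (ext g) w a := by
    intro g w a hw
    simp [T, T₀]
  have hmem : ∀ (w : Word) (a : Fin 3), w.length = m → w ++ [a] ∈ wordsOf (m + 1) := by
    intro w a hw; simpa using hw
  have hinj : Function.Injective T := by
    rw [injective_iff_map_eq_zero]
    intro g hg
    have h0 : ∀ w a, w.length = m →
        (if prv a w = none then ext g (w ++ [a]) else adjOp p (ext g) w a) = 0 := by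
      intro w a hw
      rw [← key g w a (hmem w a hw), hg]; rfl
    have h1 : AdjHarmonic p (m + 1) (ext g) := by
      intro w a hw ha
      simpa [ha] using h0 w a (by omega)
    have h2 : ∀ j, ext g (rep (m + 1) j) = 0 := by
      intro j
      have h3 := h0 (rep m j) j (by simp)
      rw [if_pos (prv_eq_none.2 (by simp)), rep_succ'] at h3
      exact h3
    funext x
    have h3 := h1.eq_zero hp h2 (mem_wordsOf.1 x.2)
    simp only [ext, dif_pos x.2] at h3
    exact h3
  obtain ⟨g, hg⟩ := LinearMap.injective_iff_surjective.1 hinj fun x => φ x.1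
  refine ⟨ext g, fun w a hw => ?_⟩
  have h1 := key g w a (hmem w a hw)
  rw [hg] at h1
  split_ifs with h
  · rw [if_pos h] at h1; exact h1.symm
  · rw [if_neg h] at h1; exact h1.symm

/-- Uniqueness for the Dirichlet problem on words of given length, by duality. -/
lemma harm_eq_zero {m : ℕ} {f : Word → ℝ}
    (hf : ∀ w a, w.length = m → prv a w ≠ none → harmOp p f w a = 0)
    (h0 : ∀ j, f (rep (m + 1) j) = 0) {y : Word} (hy : y.length = m + 1) : f y = 0 := by
  classical
  rcases List.eq_nil_or_concat' y with rfl | ⟨w₀, a₀, rfl⟩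
  · simp at hy
  have hw₀ : w₀.length = m := by simpa using hy
  by_cases hc : prv a₀ w₀ = none
  · have := prv_eq_none.1 hc
    rw [this, rep_succ', hw₀]; exact h0 a₀
  obtain ⟨g, hg⟩ := exists_adj hp m fun x => if x = w₀ ++ [a₀] then 1 else 0
  have hcorner : ∀ a, g (rep m a ++ [a]) = 0 := by
    intro a
    have := hg (rep m a) a (by simp)
    rw [if_pos (prv_eq_none.2 (by simp)), if_neg] at this
    · exact this
    · intro h
      have h' := List.append_inj' h rfl
      apply hc
      rw [prv_eq_none, ← h'.1, List.length_replicate]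
      have : a = a₀ := by simpa using h'.2
      rw [this]
  have h1 := sum_mul_harmOp p m f g
  rw [sum_eq_corners m _ fun w a hw ha => by rw [hf w a hw ha, mul_zero]] at h1
  simp only [hcorner, zero_mul, Finset.sum_const_zero] at h1
  refine Eq.trans ?_ h1.symm
  symm
  rw [Finset.sum_eq_single_of_mem w₀ (by simpa using hw₀), Finset.sum_eq_single a₀]
  · have := hg w₀ a₀ hw₀
    rw [if_neg hc, if_pos rfl] at this
    rw [this, mul_one]
  · intro a _ ha
    have h2 := hg w₀ a hw₀
    have hne : w₀ ++ [a] ≠ w₀ ++ [a₀] := by simpa using ha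
    simp only [if_neg hne] at h2
    split_ifs at h2 with h3
    · have := prv_eq_none.1 h3
      rw [this, rep_succ', hw₀, h0 a, zero_mul]
    · rw [h2, mul_zero]
  · simp
  · intro w hw hne
    rw [mem_wordsOf] at hw
    refine Finset.sum_eq_zero fun a _ => ?_
    have h2 := hg w a hw
    have hne' : w ++ [a] ≠ w₀ ++ [a₀] := fun h => hne (List.append_inj' h rfl).1
    simp only [if_neg hne'] at h2
    split_ifs at h2 with h3
    · have := prv_eq_none.1 h3
      rw [this, rep_succ', hw, h0 a, zero_mul]
    · rw [h2, mul_zero]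

lemma harmOp_hitProb {w y : Word} {a : Fin 3} (h : prv a w ≠ none) (hy : w ++ [a] ≠ y) :
    harmOp p (fun x => hitProb p hp x y) w a = 0 := by
  rw [harmOp, hitProb_cell hp h hy]; ring

omit hp in
lemma ne_rep_of_prv {w : Word} {a : Fin 3} (h : prv a w ≠ none) (n : ℕ) (c : Fin 3) :
    w ++ [a] ≠ rep n c := by
  obtain ⟨i, hi⟩ := Option.ne_none_iff_exists'.1 h
  obtain ⟨hia, ω, m, rfl⟩ := prv_eq_some hi
  intro h
  have e : ω ++ i :: List.replicate (m + 1) a = ω ++ i :: rep m a ++ [a] := by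
    simp [rep, List.replicate_succ']
  exact not_replicate hia (e.trans h)

lemma hitProb_rep_rep {n : ℕ} (c d : Fin 3) :
    hitProb p hp (rep (n + 1) c) (rep (n + 1) d) = if c = d then 1 else 0 := by
  split_ifs with h
  · rw [h, hitProb_self]
  · refine hitProb_corner_of_length hp ?_ (by simp)
    intro h'
    exact h (by simpa [rep] using h')

/-- To reach a longer word the chain has to leave its level through a corner. -/
lemma hitProb_decomp {m : ℕ} {z y : Word} (hz : z.length = m + 1) (hy : m + 1 < y.length) :
    hitProb p hp z y =
      ∑ c, hitProb p hp z (rep (m + 1) c) * hitProb p hp (rep (m + 1) c) y := by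
  have key := harm_eq_zero hp (m := m) (f := fun x => hitProb p hp x y -
    ∑ c, hitProb p hp x (rep (m + 1) c) * hitProb p hp (rep (m + 1) c) y) ?_ ?_ hz
  · exact sub_eq_zero.1 key
  · intro w a hw ha
    have h1 := harmOp_hitProb hp ha (y := y) (by rintro rfl; simp at hy; omega)
    have h2 := fun c => harmOp_hitProb hp ha (ne_rep_of_prv ha (m + 1) c)
    simp only [harmOp, sum_letters (show (0 : Fin 3) ≠ 1 by decide) (show (0 : Fin 3) ≠ 2 by decide)
      (show (1 : Fin 3) ≠ 2 by decide)] at h1 h2 ⊢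
    linear_combination h1 - h2 0 * hitProb p hp (rep (m + 1) 0) y -
      h2 1 * hitProb p hp (rep (m + 1) 1) y - h2 2 * hitProb p hp (rep (m + 1) 2) y
  · intro j
    simp [hitProb_rep_rep]

/-- The hitting probability from a corner in terms of the defect of the harmonic equation at the
corresponding corner of the next level. -/
lemma hitProb_rep_eq {n : ℕ} (c : Fin 3) {y : Word} (hy : rep n c ≠ y) :
    hitProb p hp (rep n c) y = hitProb p hp (rep (n + 1) c) y -
      2 / (3 * (1 - p)) * harmOp p (fun x => hitProb p hp x y) (rep n c) c := by
  obtain ⟨a, b, hca, hcb, hab⟩ := exists_others c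
  have h1 : 1 - p ≠ 0 := by have := hp.2; intro h; linarith
  rw [hitProb_corner hp hy, harmOp, sum_letters hca hcb hab, sum_letters hca hcb hab]
  simp only [tau, hca.symm, hcb.symm, if_true, if_false, rep_succ', conj_rep,
    prv_eq_none.2 (show rep n c = rep (rep n c).length c by simp)]
  field_simp
  ring

/-- The adjoint solution on words of length `m + 1` with value `1` at the corner `c` and `0` at
the two other corners. Up to a constant factor its value at a word `y` that is not a corner is the
expected number of visits to `y` of the chain started at `c ⋯ c k` with uniformly chosen `k ≠ c`. -/
def green (m : ℕ) (c : Fin 3) : Word → ℝ :=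
  (exists_adj hp m fun x => if x = rep (m + 1) c then 1 else 0).choose

/-- The sum of `green` over the three corners. -/
def greenSum (m : ℕ) (y : Word) : ℝ := ∑ c, green hp m c y

lemma green_rep (m : ℕ) (c d : Fin 3) : green hp m c (rep (m + 1) d) = if c = d then 1 else 0 := by
  have h := (exists_adj hp m fun x => if x = rep (m + 1) c then 1 else 0).choose_spec
    (rep m d) d (by simp)
  rw [if_pos (prv_eq_none.2 (by simp)), rep_succ'] at h
  rw [green, h]
  refine if_congr ?_ rfl rfl
  simp [eq_comm]

lemma green_adj (m : ℕ) (c : Fin 3) : AdjHarmonic p (m + 1) (green hp m c) := by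
  intro w a hw ha
  have h := (exists_adj hp m fun x => if x = rep (m + 1) c then 1 else 0).choose_spec
    w a (by omega)
  rw [if_neg ha, if_neg (ne_rep_of_prv ha _ c)] at h
  exact h

lemma greenSum_adj (m : ℕ) : AdjHarmonic p (m + 1) (greenSum hp m) := by
  have h : greenSum hp m = fun x => 1 * (1 * green hp m 0 x + 1 * green hp m 1 x) +
      1 * green hp m 2 x := by
    funext x
    rw [greenSum, sum_letters (show (0 : Fin 3) ≠ 1 by decide) (show (0 : Fin 3) ≠ 2 by decide)
      (show (1 : Fin 3) ≠ 2 by decide)]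
    ring
  rw [h]
  exact ((green_adj hp m 0).lincomb (green_adj hp m 1) 1 1).lincomb (green_adj hp m 2) 1 1

lemma greenSum_rep (m : ℕ) (d : Fin 3) : greenSum hp m (rep (m + 1) d) = 1 := by
  simp [greenSum, green_rep]

lemma greenSum_pos {m : ℕ} {y : Word} (hy : y.length = m + 1) : 0 < greenSum hp m y := by
  simpa using (greenSum_adj hp m).pos hp (w := []) (v := y) (by simpa using hy)
    (fun j => by simp [hy, greenSum_rep])

lemma green_nonneg {m : ℕ} (c : Fin 3) {y : Word} (hy : y.length = m + 1) :
    0 ≤ green hp m c y := by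
  refine (green_adj hp m c).nonneg hp (w := []) (v := y) (by simpa using hy) fun j => ?_
  simp only [List.nil_append, hy, green_rep]
  split_ifs <;> norm_num

/-- The transition probabilities between the corners of consecutive levels. -/
lemma hitProb_rep_succ {n : ℕ} (hn : 1 ≤ n) (c d : Fin 3) :
    hitProb p hp (rep n c) (rep (n + 1) d) =
      (if c = d then 1 - dpar p n / dpar p 0 else 0) + dpar p n / dpar p 0 / 3 := by
  have h1 := sum_mul_harmOp p n (fun x => hitProb p hp x (rep (n + 1) d)) (green hp n c)
  rw [sum_eq_corners n _ fun w a hw ha => by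
      rw [harmOp_hitProb hp ha (ne_rep_of_prv ha (n + 1) d), mul_zero],
    sum_eq_corners n _ fun w a hw ha => by
      rw [green_adj hp n c w a (by omega) ha, mul_zero]] at h1
  simp only [rep_succ', green_rep, hitProb_rep_rep, ite_mul, one_mul, zero_mul,
    Finset.sum_ite_eq, Finset.sum_ite_eq', Finset.mem_univ, if_true] at h1
  have h2 := (green_adj hp n c).corner hp (by omega) d
  simp only [Nat.add_sub_cancel] at h2
  rw [hitProb_rep_eq hp c (by intro h; simpa using congrArg List.length h), h1, h2,
    hitProb_rep_rep, green_rep]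
  obtain ⟨a, b, hda, hdb, hab⟩ := exists_others d
  have h3 : inflow p (green hp n c) n [] d =
      1 / 2 * ((if c = a then 1 else 0) + if c = b then 1 else 0) := by
    rw [inflow, sum_letters hda hdb hab, tau_self, tau_nil _ hda, tau_nil _ hdb]
    simp only [List.nil_append, green_rep]
    ring
  have h4 : (if c = d then (1 : ℝ) else 0) + ((if c = a then 1 else 0) + if c = b then 1 else 0)
      = 1 := by
    have := sum_letters hda hdb hab fun i => if c = i then (1 : ℝ) else 0
    simp only [Finset.sum_ite_eq, Finset.mem_univ, if_true] at this
    linarith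
  have h5 : 1 - p ≠ 0 := by have := hp.2; intro h; linarith
  have h6 := (dpar_pos hp 0).ne'
  rw [h3, eq_sub_of_add_eq' h4]
  split_ifs <;> field_simp <;> ring

/-- Duality: the hitting probability of `y` from a corner is, up to a factor that does not depend
on the corner, given by the adjoint solution. -/
lemma exists_hitProb_eq_green {n : ℕ} {w : Word} {a : Fin 3} (hw : w.length = n)
    (ha : prv a w ≠ none) : ∃ s : ℝ, s ≠ 0 ∧ ∀ c,
      hitProb p hp (rep n c) (w ++ [a]) = s * green hp n c (w ++ [a]) := by
  classical
  set f : Word → ℝ := fun x => hitProb p hp x (w ++ [a]) with hf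
  have hcorner : ∀ j, f (rep (n + 1) j) = 0 := fun j =>
    hitProb_corner_of_length hp (ne_rep_of_prv ha _ j).symm (by simp [hw])
  have h5 : 0 < 1 - p := by have := hp.2; linarith
  have hL : ∀ w' a', w'.length = n → prv a' w' ≠ none → w' ++ [a'] ≠ w ++ [a] →
      harmOp p f w' a' = 0 := fun w' a' _ ha' hne => harmOp_hitProb hp ha' hne
  refine ⟨2 / (3 * (1 - p)) * harmOp p f w a, ?_, fun c => ?_⟩
  · refine mul_ne_zero (by positivity) fun h0 => ?_
    have h1 : f (w ++ [a]) = 0 := by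
      refine harm_eq_zero hp (m := n) (fun w' a' hw' ha' => ?_) hcorner (by simp [hw])
      by_cases hne : w' ++ [a'] = w ++ [a]
      · have h' := List.append_inj' hne rfl
        rw [h'.1, show a' = a by simpa using h'.2]
        exact h0
      · exact hL w' a' hw' ha' hne
    rw [hf] at h1
    simp [hitProb_self] at h1
  · have hne : rep n c ≠ w ++ [a] := by
      intro h; have := congrArg List.length h; simp [hw] at this
    rw [hitProb_rep_eq hp c hne]
    have h1 := sum_mul_harmOp p n f (green hp n c)
    rw [sum_eq_corners n (fun w a => f (w ++ [a]) * adjOp p (green hp n c) w a)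
      fun w a hw ha => by rw [green_adj hp n c w a (by omega) ha, mul_zero]] at h1
    simp only [rep_succ', hcorner, zero_mul, Finset.sum_const_zero] at h1
    set F : Word → Fin 3 → ℝ := fun w a => green hp n c (w ++ [a]) * harmOp p f w a with hF
    have h2 := sum_eq_corners n (fun w' a' => F w' a' - if w' = w then if a' = a then F w a
      else 0 else 0) ?_
    · simp only [Finset.sum_sub_distrib] at h2
      rw [h1] at h2
      have h3 : ∑ w' ∈ wordsOf n, ∑ a', (if w' = w then if a' = a then F w a else 0 else 0) =
          F w a := by
        rw [Finset.sum_eq_single_of_mem w (by simpa using hw)]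
        · simp
        · intro b _ hb; simp [hb]
      have h4 : ∀ a', (if rep n a' = w then if a' = a then F w a else 0 else 0) = 0 := by
        intro a'
        split_ifs with h h'
        · exfalso
          apply ha
          rw [prv_eq_none, ← h, h']; simp
        · rfl
        · rfl
      rw [h3] at h2
      simp only [h4, Finset.sum_const_zero, sub_zero] at h2
      simp only [hF, rep_succ', green_rep, ite_mul, one_mul,
        zero_mul, Finset.sum_ite_eq, Finset.mem_univ, if_true, zero_sub] at h2
      change f (rep (n + 1) c) - 2 / (3 * (1 - p)) * harmOp p f (rep n c) c = _
      rw [hcorner, ← h2]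
      ring
    · intro w' a' hw' ha'
      by_cases h : w' = w ∧ a' = a
      · simp [h.1, h.2]
      · have h0 : harmOp p f w' a' = 0 := hL w' a' hw' ha' fun h' => h (by
          have h'' := List.append_inj' h' rfl
          exact ⟨h''.1, by simpa using h''.2⟩)
        simp only [hF, h0, mul_zero, zero_sub, neg_eq_zero]
        split_ifs with h1 h2
        · exact absurd ⟨h1, h2⟩ h
        · rfl
        · rfl

/-- The conditional law of the corner of level `n` through which the chain passed on its way to
a word `y` of length `n + 1`, compared with the normalized adjoint solutions. -/
lemma abs_hitProb_div_sub_le {n : ℕ} (hn : 1 ≤ n) {y : Word} (hy : y.length = n + 1) :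
    (0 < ∑ d, hitProb p hp (rep n d) y) ∧ ∀ c,
      |hitProb p hp (rep n c) y / (∑ d, hitProb p hp (rep n d) y) -
        green hp n c y / greenSum hp n y| ≤ dpar p n / dpar p 0 := by
  have hx : 0 ≤ dpar p n / dpar p 0 := (div_pos (dpar_pos hp n) (dpar_pos hp 0)).le
  rcases List.eq_nil_or_concat' y with rfl | ⟨w, a, rfl⟩
  · simp at hy
  have hw : w.length = n := by simpa using hy
  by_cases ha : prv a w = none
  · have e : w ++ [a] = rep (n + 1) a := by
      conv_lhs => rw [prv_eq_none.1 ha, rep_succ', hw]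
    have hs : ∑ d, hitProb p hp (rep n d) (rep (n + 1) a) = 1 := by
      simp only [hitProb_rep_succ hp hn, Finset.sum_add_distrib, Finset.sum_ite_eq',
        Finset.mem_univ, if_true, Finset.sum_const, Finset.card_univ, Fintype.card_fin]
      simp
      ring
    rw [e, hs]
    refine ⟨one_pos, fun c => ?_⟩
    rw [div_one, greenSum_rep, div_one, green_rep, hitProb_rep_succ hp hn, abs_le]
    split_ifs <;> constructor <;> linarith
  · obtain ⟨s, hs0, hs⟩ := exists_hitProb_eq_green hp hw ha
    have hG := greenSum_pos hp (m := n) hy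
    have e : ∑ d, hitProb p hp (rep n d) (w ++ [a]) = s * greenSum hp n (w ++ [a]) := by
      simp only [hs, greenSum, Finset.mul_sum]
    have h0 : 0 ≤ ∑ d, hitProb p hp (rep n d) (w ++ [a]) :=
      Finset.sum_nonneg fun d _ => hitProb_nonneg hp _ _
    refine ⟨lt_of_le_of_ne h0 (by rw [e]; exact (mul_ne_zero hs0 hG.ne').symm), fun c => ?_⟩
    rw [e, hs, mul_div_mul_left _ _ hs0, sub_self, abs_zero]
    exact hx

end

/-! ### Infinite words and codings of gasket-like sets -/

section

lemma length_pre (x : InfWord) (n : ℕ) : (x.pre n).length = n := by simp [InfWord.pre]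

lemma pre_eq_pre_iff {x y : InfWord} {n : ℕ} : x.pre n = y.pre n ↔ ∀ k < n, x k = y k := by
  simp [InfWord.pre]

lemma pre_succ (x : InfWord) (n : ℕ) : x.pre (n + 1) = x.pre n ++ [x n] := by
  simp [InfWord.pre, List.range_succ]

/-- The shift on infinite words. -/
def shift (x : InfWord) : InfWord := fun n => x (n + 1)

lemma pre_succ' (x : InfWord) (n : ℕ) : x.pre (n + 1) = x 0 :: (shift x).pre n := by
  simp [InfWord.pre, List.range_succ_eq_map, shift, Function.comp_def]

lemma take_pre (x : InfWord) {m n : ℕ} (h : m ≤ n) : (x.pre n).take m = x.pre m := by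
  simp [InfWord.pre, ← List.map_take, List.take_range, h]

lemma eventually_pre_eq (x : InfWord) (m : ℕ) : ∀ᶠ y in 𝓝 x, y.pre m = x.pre m := by
  induction m with
  | zero => simp [InfWord.pre]
  | succ m ih =>
    have h : ∀ᶠ y : InfWord in 𝓝 x, y m = x m := by
      have := (continuous_apply m).continuousAt (x := x)
      exact this (isOpen_discrete {x m} |>.mem_nhds rfl)
    filter_upwards [ih, h] with y h1 h2
    rw [pre_succ, pre_succ, h1, h2]

/-- The relation on infinite words that the coding of the gasket induces: two different words are
related if they are `ω i j j j ⋯` and `ω j i i i ⋯`. -/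
def Glued (x y : InfWord) : Prop :=
  x = y ∨ ∃ n, (∀ k < n, x k = y k) ∧ x n ≠ y n ∧ ∀ k > n, x k = y n ∧ y k = x n

/-- Three maps `A i` of the standard triangle, one for each corner, whose images meet exactly
at the points `A i e_j = A j e_i`. The `i`-th coordinate is at least `θ` on the image of `A i`,
and at most `θ` on the images of the other maps, with equality only at the common point. -/
structure IsGasketSystem (A : Fin 3 → (Fin 3 → ℝ) → Fin 3 → ℝ) (θ : ℝ) : Prop where
  eq_of_fixed : ∀ i, ∀ v ∈ stdSimplex ℝ (Fin 3), A i v = v → v = Pi.single i 1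
  fixed : ∀ i, A i (Pi.single i 1) = Pi.single i 1
  inj : ∀ i, ∀ v ∈ stdSimplex ℝ (Fin 3), ∀ v' ∈ stdSimplex ℝ (Fin 3), A i v = A i v' → v = v'
  glue : ∀ i j, i ≠ j → A i (Pi.single j 1) = A j (Pi.single i 1)
  high : ∀ i, ∀ v ∈ stdSimplex ℝ (Fin 3), θ ≤ A i v i
  low : ∀ i j, i ≠ j → ∀ v ∈ stdSimplex ℝ (Fin 3), A j v i ≤ θ
  eq_of_low : ∀ i j, i ≠ j → ∀ v ∈ stdSimplex ℝ (Fin 3), A j v i = θ → v = Pi.single i 1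
  lt_one : θ < 1

namespace IsGasketSystem

variable {A : Fin 3 → (Fin 3 → ℝ) → Fin 3 → ℝ} {θ : ℝ} (hA : IsGasketSystem A θ)
  {F : InfWord → Fin 3 → ℝ} (hF : ∀ x, F x = A (x 0) (F (shift x)))
  (hΔ : ∀ x, F x ∈ stdSimplex ℝ (Fin 3))
include hA hF hΔ

lemma code_const (j : Fin 3) {x : InfWord} (hx : ∀ n, x n = j) : F x = Pi.single j 1 := by
  have h : shift x = x := by funext n; simp [shift, hx]
  refine hA.eq_of_fixed j _ (hΔ x) ?_
  conv_rhs => rw [hF x, h, hx 0]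

lemma eq_const_of_code {j : Fin 3} (n : ℕ) {x : InfWord} (hx : F x = Pi.single j 1) : x n = j := by
  have key : ∀ x, F x = Pi.single j 1 → x 0 = j ∧ F (shift x) = Pi.single j 1 := by
    intro x hx
    have h0 : x 0 = j := by
      by_contra hne
      have h1 := hA.low j (x 0) (Ne.symm hne) _ (hΔ (shift x))
      rw [← hF, hx, Pi.single_eq_same] at h1
      exact absurd h1 (not_le.2 hA.lt_one)
    refine ⟨h0, hA.inj j _ (hΔ _) _ (single_mem_stdSimplex ℝ j) ?_⟩
    rw [← h0, ← hF, hx, h0, hA.fixed]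
  induction n generalizing x with
  | zero => exact (key x hx).1
  | succ n ih => exact ih (key x hx).2

/-- The identifications made by a coding do not depend on the maps. -/
theorem code_eq_iff (x y : InfWord) : F x = F y ↔ Glued x y := by
  constructor
  · intro h
    by_contra hg
    simp only [Glued, not_or, not_exists] at hg
    obtain ⟨hne, hg⟩ := hg
    have hex : ∃ n, x n ≠ y n := by
      by_contra! h'; exact hne (funext h')
    have main : ∀ n (x y : InfWord), F x = F y → (∀ k < n, x k = y k) → x n ≠ y n →
        ∀ k > n, x k = y n ∧ y k = x n := by
      intro n
      induction n with
      | zero =>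
        intro x y h _ hxy k hk
        obtain ⟨k, rfl⟩ := Nat.exists_eq_add_of_le' hk
        have half : ∀ x y : InfWord, F x = F y → x 0 ≠ y 0 → F (shift y) = Pi.single (x 0) 1 := by
          intro x y h hxy
          refine hA.eq_of_low (x 0) (y 0) hxy _ (hΔ _) (le_antisymm (hA.low _ _ hxy _ (hΔ _)) ?_)
          rw [← hF, ← h, hF]
          exact hA.high _ _ (hΔ _)
        exact ⟨hA.eq_const_of_code hF hΔ k (half y x h.symm hxy.symm),
          hA.eq_const_of_code hF hΔ k (half x y h hxy)⟩
      | succ n ih =>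
        intro x y h hlt hxy k hk
        have h0 := hlt 0 (by omega)
        have h1 : F (shift x) = F (shift y) := by
          rw [hF x, hF y, h0] at h
          exact hA.inj _ _ (hΔ _) _ (hΔ _) h
        obtain ⟨k, rfl⟩ := Nat.exists_eq_add_of_le' (show 1 ≤ k by omega)
        exact ih (shift x) (shift y) h1 (fun k hk => hlt (k + 1) (by omega)) hxy k (by omega)
    exact hg (Nat.find hex) ⟨fun k hk => by simpa using Nat.find_min hex hk, Nat.find_spec hex,
      main _ x y h (fun k hk => by simpa using Nat.find_min hex hk) (Nat.find_spec hex)⟩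
  · rintro (rfl | ⟨n, h1, h2, h3⟩)
    · rfl
    · induction n generalizing x y with
      | zero =>
        rw [hF x, hF y,
          hA.code_const hF hΔ (y 0) (x := shift x) (fun n => (h3 (n + 1) (by omega)).1),
          hA.code_const hF hΔ (x 0) (x := shift y) (fun n => (h3 (n + 1) (by omega)).2)]
        exact hA.glue _ _ h2
      | succ n ih =>
        rw [hF x, hF y, h1 0 (by omega), ih (shift x) (shift y) (fun k hk => h1 (k + 1) (by omega))
          h2 (fun k hk => h3 (k + 1) (by omega))]

end IsGasketSystem

/-! ### The standard coding of the gasket -/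

/-- Barycentric coordinates with respect to the corners of the gasket. -/
def bary (q : Plane) : Fin 3 → ℝ :=
  ![2 * q 1 / Real.sqrt 3, 1 - q 0 - q 1 / Real.sqrt 3, q 0 - q 1 / Real.sqrt 3]

lemma bary_injective : Function.Injective bary := by
  intro q q' h
  have h0 := congrFun h 0
  have h2 := congrFun h 2
  simp only [bary, Matrix.cons_val] at h0 h2
  have h3 : 0 < Real.sqrt 3 := by positivity
  have e1 : q 1 = q' 1 := by
    field_simp at h0
    linarith
  have e0 : q 0 = q' 0 := by rw [e1] at h2; linarith
  ext i
  fin_cases i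
  · exact e0
  · exact e1

lemma continuous_bary : Continuous bary := by
  unfold bary
  refine continuous_pi fun i => ?_
  fin_cases i <;> simp <;> fun_prop

/-- The contraction `contr i` in barycentric coordinates. -/
def midMap (i : Fin 3) (v : Fin 3 → ℝ) : Fin 3 → ℝ := (1 / 2 : ℝ) • (v + Pi.single i 1)

lemma bary_contr (i : Fin 3) (q : Plane) : bary (contr i q) = midMap i (bary q) := by
  have h3 : Real.sqrt 3 ≠ 0 := by positivity
  funext j
  rw [midMap, Pi.smul_apply, Pi.add_apply, Pi.single_apply]
  fin_cases i <;> fin_cases j <;> simp [bary, contr, corner] <;> field_simp <;> ring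

lemma midMap_mem (i : Fin 3) {v : Fin 3 → ℝ} (hv : v ∈ stdSimplex ℝ (Fin 3)) :
    midMap i v ∈ stdSimplex ℝ (Fin 3) := by
  have h := (convex_stdSimplex ℝ (Fin 3)) hv (single_mem_stdSimplex ℝ i)
    (show (0 : ℝ) ≤ 1 / 2 by norm_num) (show (0 : ℝ) ≤ 1 / 2 by norm_num) (by norm_num)
  rwa [← smul_add] at h

/-- A point of the standard triangle with a coordinate at least `1` is a corner. -/
lemma eq_single_of_one_le {v : Fin 3 → ℝ} (hv : v ∈ stdSimplex ℝ (Fin 3)) {i : Fin 3}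
    (h : 1 ≤ v i) : v = Pi.single i 1 := by
  obtain ⟨j, k, hij, hik, hjk⟩ := exists_others i
  have hs := hv.2
  rw [sum_letters hij hik hjk] at hs
  have hj := hv.1 j
  have hk := hv.1 k
  funext l
  by_cases h1 : l = i
  · subst h1; rw [Pi.single_eq_same]; linarith
  · rw [Pi.single_eq_of_ne h1]
    by_cases h2 : l = j
    · subst h2; linarith
    · have : l = k := third_letter i j l k hij (Ne.symm h1) (Ne.symm h2) hik hjk
      subst this; linarith

lemma isGasketSystem_midMap : IsGasketSystem midMap (1 / 2) where
  eq_of_fixed i v hv h := by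
    have := congrFun h i
    simp only [midMap, Pi.smul_apply, Pi.add_apply, Pi.single_eq_same, smul_eq_mul] at this
    exact eq_single_of_one_le hv (by linarith)
  fixed i := by
    funext j
    simp only [midMap, Pi.smul_apply, Pi.add_apply, smul_eq_mul]; ring
  inj i v _ v' _ h := by
    funext j
    have := congrFun h j
    simp only [midMap, Pi.smul_apply, Pi.add_apply, smul_eq_mul] at this
    linarith
  glue i j _ := by simp only [midMap, add_comm]
  high i v hv := by
    have := hv.1 i
    simp only [midMap, Pi.smul_apply, Pi.add_apply, Pi.single_eq_same, smul_eq_mul]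
    linarith
  low i j hij v hv := by
    have : v i ≤ 1 := by
      rw [← hv.2]; exact Finset.single_le_sum (fun j _ => hv.1 j) (Finset.mem_univ i)
    simp only [midMap, Pi.smul_apply, Pi.add_apply, Pi.single_eq_of_ne hij, smul_eq_mul]
    linarith
  eq_of_low i j hij v hv h := by
    simp only [midMap, Pi.smul_apply, Pi.add_apply, Pi.single_eq_of_ne hij, smul_eq_mul] at h
    exact eq_single_of_one_le hv (by linarith)
  lt_one := by norm_num

lemma proj_eq (x : InfWord) : proj x = contr (x 0) (proj (shift x)) := by
  have h1 := (tendsto_proj x 0).comp (tendsto_add_atTop_nat 1)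
  have h2 := ((continuous_contr (x 0)).tendsto _).comp (tendsto_proj (shift x) 0)
  refine tendsto_nhds_unique h1 (h2.congr fun n => ?_)
  simp [pre_succ', contrWord]

lemma bary_proj_mem (x : InfWord) : bary (proj x) ∈ stdSimplex ℝ (Fin 3) := by
  have h1 : ∀ w : Word, bary (contrWord w 0) ∈ stdSimplex ℝ (Fin 3) := by
    intro w
    induction w with
    | nil =>
      have : bary (contrWord [] 0) = Pi.single 1 1 := by
        funext j; fin_cases j <;> simp [bary, contrWord]
      rw [this]; exact single_mem_stdSimplex ℝ 1
    | cons i w ih =>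
      rw [contrWord, Function.comp_apply, bary_contr]
      exact midMap_mem i ih
  exact (isClosed_stdSimplex ℝ (Fin 3)).mem_of_tendsto
    ((continuous_bary.tendsto _).comp (tendsto_proj x 0)) (Eventually.of_forall fun n => h1 _)

theorem proj_eq_iff (x y : InfWord) : proj x = proj y ↔ Glued x y := by
  rw [← bary_injective.eq_iff]
  exact isGasketSystem_midMap.code_eq_iff (F := fun x => bary (proj x))
    (fun x => by rw [← bary_contr, ← proj_eq]) bary_proj_mem x y

lemma norm_corner_le (i : Fin 3) : ‖corner i‖ ≤ 1 := by
  rw [EuclideanSpace.norm_eq]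
  refine Real.sqrt_le_one.2 ?_
  fin_cases i <;> simp [corner, Fin.sum_univ_two, div_pow]
  norm_num

lemma norm_proj_le (x : InfWord) : ‖proj x‖ ≤ 1 := by
  have h1 : ∀ w : Word, ‖contrWord w 0‖ ≤ 1 := by
    intro w
    induction w with
    | nil => simp [contrWord]
    | cons i w ih =>
      rw [contrWord, Function.comp_apply, contr, norm_smul]
      have := norm_add_le (contrWord w 0) (corner i)
      have := norm_corner_le i
      norm_num
      linarith
  exact le_of_tendsto (tendsto_proj x 0).norm (Eventually.of_forall fun n => h1 _)

lemma dist_proj_le {x y : InfWord} (n : ℕ) (h : ∀ k < n, x k = y k) :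
    dist (proj x) (proj y) ≤ (1 / 2) ^ n * 2 := by
  induction n generalizing x y with
  | zero =>
    have h1 := norm_proj_le x
    have h2 := norm_proj_le y
    have := dist_le_norm_add_norm (proj x) (proj y)
    simp; linarith
  | succ n ih =>
    have h1 := ih (x := shift x) (y := shift y) fun k hk => h (k + 1) (by omega)
    have h2 : ∀ c d : Plane, dist (contr (y 0) c) (contr (y 0) d) = (1 / 2) * dist c d := by
      intro c d; simp [contr, dist_smul₀]
    rw [proj_eq x, proj_eq y, h 0 (by omega), h2, pow_succ]
    linarith

lemma continuous_proj : Continuous proj := by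
  rw [continuous_iff_continuousAt]
  intro x
  rw [ContinuousAt, Metric.tendsto_nhds]
  intro ε hε
  obtain ⟨n, hn⟩ := exists_pow_lt_of_lt_one (half_pos hε) (show (1 / 2 : ℝ) < 1 by norm_num)
  filter_upwards [eventually_pre_eq x n] with y hy
  have := dist_proj_le n (pre_eq_pre_iff.1 hy)
  linarith

theorem range_proj : range proj = gasket := by
  refine existsUnique_attractor.unique ⟨isCompact_range continuous_proj, range_nonempty _, ?_⟩
    existsUnique_attractor.choose_spec.1
  ext q
  simp only [mem_range, mem_iUnion, mem_image, exists_exists_eq_and]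
  constructor
  · rintro ⟨x, rfl⟩; exact ⟨x 0, shift x, (proj_eq x).symm⟩
  · rintro ⟨i, x, rfl⟩
    refine ⟨fun n => Nat.casesOn n i x, ?_⟩
    rw [proj_eq]; rfl

/-! ### Harmonic coordinates on the gasket -/

/-- Harmonic extension from the corners of a cell to the corners of its subcell `i`, in
coordinates: the corner `i` stays, and the corner `j ≠ i` of the subcell is sent to
`(2 e_i + 2 e_j + e_k) / 5`, with `k` the third letter. -/
def harmMap (i : Fin 3) : (Fin 3 → ℝ) →ₗ[ℝ] Fin 3 → ℝ where
  toFun v j := if j = i then (3 * v i + 2 * ∑ l, v l) / 5 else (v j + ∑ l, v l - v i) / 5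
  map_add' v v' := by
    funext j
    simp only [Pi.add_apply, Finset.sum_add_distrib]
    split_ifs <;> ring
  map_smul' c v := by
    funext j
    simp only [Pi.smul_apply, smul_eq_mul, ← Finset.mul_sum, RingHom.id_apply]
    split_ifs <;> ring

lemma harmMap_apply (i : Fin 3) (v : Fin 3 → ℝ) (j : Fin 3) :
    harmMap i v j = if j = i then (3 * v i + 2 * ∑ l, v l) / 5 else (v j + ∑ l, v l - v i) / 5 :=
  rfl

lemma sum_harmMap (i : Fin 3) (v : Fin 3 → ℝ) : ∑ j, harmMap i v j = ∑ j, v j := by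
  obtain ⟨j, k, hij, hik, hjk⟩ := exists_others i
  rw [sum_letters hij hik hjk]
  simp only [harmMap_apply, if_true, hij.symm, hik.symm, if_false, sum_letters hij hik hjk]
  ring

lemma harmMap_mem (i : Fin 3) {v : Fin 3 → ℝ} (hv : v ∈ stdSimplex ℝ (Fin 3)) :
    harmMap i v ∈ stdSimplex ℝ (Fin 3) := by
  refine ⟨fun j => ?_, by rw [sum_harmMap]; exact hv.2⟩
  have h1 := hv.1 i
  have h2 := hv.1 j
  have h3 : v i ≤ ∑ l, v l := Finset.single_le_sum (fun j _ => hv.1 j) (Finset.mem_univ i)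
  rw [harmMap_apply]
  split_ifs <;> linarith

lemma harmMap_single_self (i : Fin 3) : harmMap i (Pi.single i 1) = Pi.single i 1 := by
  funext j
  rw [harmMap_apply]
  split_ifs with h
  · subst h; simp; norm_num
  · simp [h]

lemma harmMap_single {i j k : Fin 3} (hij : i ≠ j) (hik : i ≠ k) (hjk : j ≠ k) :
    harmMap i (Pi.single j 1) = (2 / 5 : ℝ) • Pi.single i 1 + (2 / 5 : ℝ) • Pi.single j 1 +
      (1 / 5 : ℝ) • Pi.single k 1 := by
  funext l
  have hl : l = i ∨ l = j ∨ l = k := by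
    by_contra! h
    exact h.2.2 (third_letter i j l k hij h.1.symm h.2.1.symm hik hjk)
  rw [harmMap_apply]
  rcases hl with rfl | rfl | rfl
  · simp [hij, hik]
  · simp [hij, hij.symm, hjk]; norm_num
  · simp [hij, hjk.symm, hik.symm]

lemma isGasketSystem_harmMap : IsGasketSystem (fun i => harmMap i) (2 / 5) where
  eq_of_fixed i v hv h := by
    have := congrFun h i
    simp only [harmMap_apply, if_true, hv.2] at this
    exact eq_single_of_one_le hv (by linarith)
  fixed := harmMap_single_self
  inj i v hv v' hv' h := by
    have e : ∀ j, harmMap i v j = harmMap i v' j := fun j => congrFun h j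
    simp only [harmMap_apply, hv.2, hv'.2] at e
    have hi := e i
    simp only [if_true] at hi
    funext j
    have hj := e j
    split_ifs at hj with h1
    · subst h1; linarith
    · linarith
  glue i j hij := by
    obtain ⟨k, hki, hkj⟩ := exists_third hij
    simp only [harmMap_single hij hki.symm hkj.symm, harmMap_single hij.symm hkj.symm hki.symm]
    abel
  high i v hv := by
    have := hv.1 i
    simp only [harmMap_apply, if_true, hv.2]
    linarith
  low i j hij v hv := by
    have h1 : v i ≤ 1 := by
      rw [← hv.2]; exact Finset.single_le_sum (fun j _ => hv.1 j) (Finset.mem_univ i)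
    have h2 := hv.1 j
    simp only [harmMap_apply, hij, if_false, hv.2]
    linarith
  eq_of_low i j hij v hv h := by
    have h2 := hv.1 j
    simp only [harmMap_apply, hij, if_false, hv.2] at h
    exact eq_single_of_one_le hv (by linarith)
  lt_one := by norm_num

/-- The composition of the maps `harmMap` along a word: its value at `e_j` is the point with
harmonic coordinates those of the corner `j` of the cell. -/
def harmWord : Word → (Fin 3 → ℝ) →ₗ[ℝ] Fin 3 → ℝ
  | [] => LinearMap.id
  | i :: w => harmMap i ∘ₗ harmWord w

lemma harmWord_append (w w' : Word) (v : Fin 3 → ℝ) :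
    harmWord (w ++ w') v = harmWord w (harmWord w' v) := by
  induction w with
  | nil => rfl
  | cons i w ih => simp [harmWord, ih]

lemma harmWord_mem (w : Word) {v : Fin 3 → ℝ} (hv : v ∈ stdSimplex ℝ (Fin 3)) :
    harmWord w v ∈ stdSimplex ℝ (Fin 3) := by
  induction w with
  | nil => exact hv
  | cons i w ih => exact harmMap_mem i ih

/-- On vectors with vanishing coordinate sum the maps `harmMap` contract the sup norm by `3/5`. -/
lemma harmWord_contract (w : Word) {v : Fin 3 → ℝ} {C : ℝ} (h0 : ∑ j, v j = 0)
    (hv : ∀ j, |v j| ≤ C) :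
    (∑ j, harmWord w v j = 0) ∧ ∀ j, |harmWord w v j| ≤ (3 / 5) ^ w.length * C := by
  induction w with
  | nil => exact ⟨h0, by simpa [harmWord] using hv⟩
  | cons i w ih =>
    obtain ⟨h1, h2⟩ := ih
    simp only [harmWord, LinearMap.comp_apply]
    refine ⟨by rw [sum_harmMap, h1], fun j => ?_⟩
    have hi := abs_le.1 (h2 i)
    have hj := abs_le.1 (h2 j)
    rw [harmMap_apply, h1, List.length_cons, pow_succ, abs_le]
    split_ifs <;> constructor <;> nlinarith

lemma abs_harmWord_sub_le (w : Word) {v v' : Fin 3 → ℝ} (hv : v ∈ stdSimplex ℝ (Fin 3))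
    (hv' : v' ∈ stdSimplex ℝ (Fin 3)) (j : Fin 3) :
    |harmWord w v j - harmWord w v' j| ≤ (3 / 5) ^ w.length := by
  have h1 : ∀ u ∈ stdSimplex ℝ (Fin 3), ∀ i, 0 ≤ u i ∧ u i ≤ 1 := fun u hu i =>
    ⟨hu.1 i, by rw [← hu.2]; exact Finset.single_le_sum (fun j _ => hu.1 j) (Finset.mem_univ i)⟩
  have := (harmWord_contract w (v := v - v') (C := 1) (by simp [hv.2, hv'.2]) fun i => by
    have := h1 v hv i
    have := h1 v' hv' i
    rw [Pi.sub_apply, abs_le]; constructor <;> linarith).2 j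
  simpa using this

/-- The harmonic coordinates of the point with code `x`. -/
def harmCode (x : InfWord) : Fin 3 → ℝ :=
  limUnder atTop fun n => harmWord (x.pre n) (Pi.single 0 1)

lemma tendsto_harmCode (x : InfWord) :
    Tendsto (fun n => harmWord (x.pre n) (Pi.single 0 1)) atTop (𝓝 (harmCode x)) := by
  refine CauchySeq.tendsto_limUnder ?_
  refine cauchySeq_of_le_geometric (3 / 5) 1 (by norm_num) fun n => ?_
  rw [dist_pi_le_iff (by positivity)]
  intro j
  rw [pre_succ, harmWord_append, Real.dist_eq, one_mul]
  conv_rhs => rw [← length_pre x n]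
  exact abs_harmWord_sub_le _ (single_mem_stdSimplex ℝ 0)
    (harmWord_mem _ (single_mem_stdSimplex ℝ 0)) j

lemma harmCode_mem (x : InfWord) : harmCode x ∈ stdSimplex ℝ (Fin 3) :=
  (isClosed_stdSimplex ℝ (Fin 3)).mem_of_tendsto (tendsto_harmCode x)
    (Eventually.of_forall fun _ => harmWord_mem _ (single_mem_stdSimplex ℝ 0))

lemma harmCode_eq (x : InfWord) : harmCode x = harmMap (x 0) (harmCode (shift x)) := by
  have h1 := (tendsto_harmCode x).comp (tendsto_add_atTop_nat 1)
  have h2 := ((harmMap (x 0)).continuous_of_finiteDimensional.tendsto _).comp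
    (tendsto_harmCode (shift x))
  refine tendsto_nhds_unique h1 (h2.congr fun n => ?_)
  simp [pre_succ', harmWord]

lemma abs_harmWord_sub_harmCode_le (x : InfWord) (m : ℕ) {v : Fin 3 → ℝ}
    (hv : v ∈ stdSimplex ℝ (Fin 3)) (j : Fin 3) :
    |harmWord (x.pre m) v j - harmCode x j| ≤ (3 / 5) ^ m := by
  have h : harmCode x = harmWord (x.pre m) (harmCode (shift^[m] x)) := by
    induction m generalizing x with
    | zero => rfl
    | succ m ih =>
      rw [harmCode_eq, ih (shift x), pre_succ', Function.iterate_succ_apply]; rfl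
  rw [h]
  conv_rhs => rw [← length_pre x m]
  exact abs_harmWord_sub_le _ hv (harmCode_mem _) j

theorem harmCode_eq_iff (x y : InfWord) : harmCode x = harmCode y ↔ Glued x y :=
  isGasketSystem_harmMap.code_eq_iff harmCode_eq harmCode_mem x y

end

/-! ### Limits of the adjoint solutions -/

section

variable {p : ℝ} (hp : p ∈ Ioo (0 : ℝ) (1 / 2))

/-- One step of the passage to the limit: as the size of the cells grows, the values at the inner
corners of a cell approach the harmonic extension (the `2/5, 2/5, 1/5` rule) of the values at its
outer corners. -/
lemma tendsto_inner {G τ : ℕ → Fin 3 → Fin 3 → ℝ} {d t : ℕ → ℝ} {L : Fin 3 → ℝ}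
    (hI : ∀ k, InnerEq (d k) (t k) (τ k) (G k)) (hd : ∀ k, d k ≠ 0) (ht : ∀ k, t k < 1)
    (hτ : ∀ k, ∀ a b c : Fin 3, a ≠ b → a ≠ c → b ≠ c → τ k a b + τ k a c = 1)
    (hG : ∀ k a b, 0 ≤ G k a b)
    (hd0 : Tendsto d atTop (𝓝 0)) (ht2 : Tendsto t atTop (𝓝 (1 / 2)))
    (hτ2 : ∀ a b, a ≠ b → Tendsto (fun k => τ k a b) atTop (𝓝 (1 / 2)))
    (hL : ∀ a, Tendsto (fun k => G k a a) atTop (𝓝 (L a)))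
    {a b c : Fin 3} (hab : a ≠ b) (hac : a ≠ c) (hbc : b ≠ c) :
    Tendsto (fun k => G k a b) atTop (𝓝 ((2 * L a + 2 * L b + L c) / 5)) := by
  have hS : ∀ a b c : Fin 3, a ≠ b → a ≠ c → b ≠ c →
      Tendsto (fun k => G k a b + G k a c) atTop
        (𝓝 (4 / 5 * L a + 3 / 5 * (L b + L c))) := by
    intro a b c hab hac hbc
    have hden : Tendsto (fun k => 2 + t k + (1 - t k) * (1 + t k) * d k) atTop
        (𝓝 (2 + 1 / 2 + (1 - 1 / 2) * (1 + 1 / 2) * 0)) :=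
      (ht2.const_add 2).add (((ht2.const_sub 1).mul (ht2.const_add 1)).mul hd0)
    have hnum : Tendsto (fun k => (1 + t k) * G k a a - ((τ k b a + t k * τ k b c) * G k b b +
        (τ k c a + t k * τ k c b) * G k c c)) atTop (𝓝 ((1 + 1 / 2) * L a -
          ((1 / 2 + 1 / 2 * (1 / 2)) * L b + (1 / 2 + 1 / 2 * (1 / 2)) * L c))) :=
      ((ht2.const_add 1).mul (hL a)).sub ((((hτ2 b a hab.symm).add
        (ht2.mul (hτ2 b c hbc))).mul (hL b)).add (((hτ2 c a hac.symm).add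
        (ht2.mul (hτ2 c b hbc.symm))).mul (hL c)))
    have hq := hnum.div hden (by norm_num)
    have hfin := ((hL a).sub hq).div (ht2.const_sub 1) (by norm_num)
    have e : 4 / 5 * L a + 3 / 5 * (L b + L c) = (L a - ((1 + 1 / 2) * L a -
          ((1 / 2 + 1 / 2 * (1 / 2)) * L b + (1 / 2 + 1 / 2 * (1 / 2)) * L c)) /
          (2 + 1 / 2 + (1 - 1 / 2) * (1 + 1 / 2) * 0)) / (1 - 1 / 2) := by ring
    rw [e]
    refine hfin.congr' ?_
    filter_upwards [hden.eventually (eventually_ne_nhds (b := (0 : ℝ)) (by norm_num))] with k hk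
    have h1 : 1 - t k ≠ 0 := by linarith [ht k]
    simp only [Pi.div_apply]
    rw [← (hI k).outer (hd k) (hτ k) hab hac hbc, mul_div_cancel_left₀ _ hk, div_eq_iff h1]
    ring
  have hT : Tendsto (fun k => G k a c + G k b c) atTop
      (𝓝 (4 / 5 * L c + 3 / 5 * (L a + L b))) := by
    have h1 := hS c a b hac.symm hbc.symm hab
    have h2 := h1.sub (hd0.mul ((hL c).sub ((ht2.const_sub 1).mul h1)))
    rw [zero_mul, sub_zero] at h2
    exact h2.congr fun k => ((hI k).swap (hτ k) hac.symm hbc.symm hab).symm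
  have hsum : Tendsto (fun k => G k a b + G k b a) atTop
      (𝓝 (1 / 2 * L a + 1 / 2 * L b + 1 / 2 * (4 / 5 * L c + 3 / 5 * (L a + L b)))) :=
    ((((hτ2 a b hab).mul (hL a)).add ((hτ2 b a hab.symm).mul (hL b))).add (ht2.mul hT)).congr
      fun k => ((hI k).pair (hd k) hab hac hbc).symm
  have hdiff : Tendsto (fun k => G k a b - G k b a) atTop (𝓝 0) := by
    have h1 := hS a b c hab hac hbc
    have hB : Tendsto (fun k => |d k| * ((G k a b + G k a c) + |τ k a b| * |G k a a| +
        |t k| * (G k a b + G k a c))) atTop (𝓝 0) := by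
      simpa using hd0.abs.mul
        ((h1.add ((hτ2 a b hab).abs.mul (hL a).abs)).add (ht2.abs.mul h1))
    refine squeeze_zero_norm (fun k => ?_) hB
    rw [(hI k) a b c hab hac hbc, norm_mul, norm_neg, Real.norm_eq_abs, Real.norm_eq_abs]
    gcongr
    have h2 := hG k a b
    have h3 := hG k a c
    have h4 := abs_sub (G k a b - τ k a b * G k a a) (t k * G k a c)
    have h5 := abs_sub (G k a b) (τ k a b * G k a a)
    rw [abs_mul] at h4 h5
    rw [abs_of_nonneg h2] at h5
    rw [abs_of_nonneg h3] at h4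
    have h6 : |t k| * G k a c ≤ |t k| * (G k a b + G k a c) := by gcongr; linarith
    linarith
  have h := (hsum.add hdiff).div_const 2
  have e : (2 * L a + 2 * L b + L c) / 5 = (1 / 2 * L a + 1 / 2 * L b +
      1 / 2 * (4 / 5 * L c + 3 / 5 * (L a + L b)) + 0) / 2 := by ring
  rw [e]
  exact h.congr fun k => by ring

include hp

/-- At the corners of a fixed cell the adjoint solutions converge to harmonic coordinates, as the
length of the words grows. -/
lemma tendsto_green (c : Fin 3) (w : Word) (j : Fin 3) :
    Tendsto (fun k => green hp (w.length + k) c (w ++ rep (k + 1) j)) atTop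
      (𝓝 (harmWord w (Pi.single j 1) c)) := by
  induction w using List.reverseRecOn generalizing j with
  | nil =>
    simp only [List.length_nil, zero_add, List.nil_append, green_rep, harmWord, LinearMap.id_apply,
      Pi.single_apply]
    exact tendsto_const_nhds
  | append_singleton w a ih =>
    have hlen : ∀ k, (w ++ [a]).length + k = w.length + (k + 1) := fun k => by simp; omega
    simp only [hlen]
    have hLa : ∀ b, Tendsto (fun k => green hp (w.length + (k + 1)) c (w ++ [b] ++ rep (k + 1) b))
        atTop (𝓝 (harmWord w (Pi.single b 1) c)) := by
      intro b
      simp only [rep_succ_append]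
      exact (ih b).comp (tendsto_add_atTop_nat 1)
    rw [harmWord_append]
    by_cases hja : a = j
    · subst hja
      have : harmWord [a] (Pi.single a 1) = Pi.single a 1 := harmMap_single_self a
      rw [this]
      exact hLa a
    · obtain ⟨i, hia, hij⟩ := exists_third hja
      have : harmWord [a] (Pi.single j 1) = harmMap a (Pi.single j 1) := rfl
      rw [this, harmMap_single hja hia.symm hij.symm]
      simp only [map_add, map_smul, Pi.add_apply, Pi.smul_apply, smul_eq_mul]
      have key := tendsto_inner
        (G := fun k a b => green hp (w.length + (k + 1)) c (w ++ [a] ++ rep (k + 1) b))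
        (τ := fun k => tau (tpar p k) w) (d := dpar p) (t := tpar p)
        (L := fun b => harmWord w (Pi.single b 1) c)
        (fun k => ((green_adj hp _ c).at hp k).innerEq (by omega))
        (fun k => (dpar_pos hp k).ne') (fun k => (tpar_mem hp k).2)
        (fun k a b c hab hac hbc => tau_add _ w hab.symm hac.symm hbc)
        (fun k a b => green_nonneg hp c (by simp; omega))
        (tendsto_dpar hp) (tendsto_tpar hp)
        (fun a b hab => tendsto_tau (tendsto_tpar hp) w hab.symm) hLa hja hia.symm hij.symm
      convert key using 2
      ring

lemma tendsto_green_div (c : Fin 3) (w : Word) (j : Fin 3) :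
    Tendsto (fun k => green hp (w.length + k) c (w ++ rep (k + 1) j) /
      greenSum hp (w.length + k) (w ++ rep (k + 1) j)) atTop
      (𝓝 (harmWord w (Pi.single j 1) c)) := by
  have h1 : Tendsto (fun k => greenSum hp (w.length + k) (w ++ rep (k + 1) j)) atTop (𝓝 1) := by
    rw [← (harmWord_mem w (single_mem_stdSimplex ℝ j)).2]
    exact tendsto_finsetSum _ fun c _ => tendsto_green hp c w j
  have h2 := (tendsto_green hp c w j).div h1 one_ne_zero
  rw [div_one] at h2
  exact h2

/-- Normalized adjoint solutions in a cell are squeezed between their values at its corners. -/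
lemma green_div_mem_Icc (c : Fin 3) {w v : Word} {k : ℕ} (hv : v.length = k + 1) {lo hi : ℝ}
    (h : ∀ j, green hp (w.length + k) c (w ++ rep (k + 1) j) /
      greenSum hp (w.length + k) (w ++ rep (k + 1) j) ∈ Icc lo hi) :
    green hp (w.length + k) c (w ++ v) / greenSum hp (w.length + k) (w ++ v) ∈ Icc lo hi := by
  have hpos : ∀ u : Word, u.length = k + 1 → 0 < greenSum hp (w.length + k) (w ++ u) :=
    fun u hu => greenSum_pos hp (by simp [hu]; omega)
  have hw : (w ++ v).length = w.length + k + 1 := by simp [hv]; omega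
  have h1 := ((green_adj hp (w.length + k) c).lincomb (greenSum_adj hp _) 1 (-lo)).nonneg hp hw
    (fun j => by
      have h1 := (h j).1
      rw [le_div_iff₀ (hpos _ (by simp))] at h1
      rw [hv]; linarith)
  have h2 := ((green_adj hp (w.length + k) c).lincomb (greenSum_adj hp _) (-1) hi).nonneg hp hw
    (fun j => by
      have h1 := (h j).2
      rw [div_le_iff₀ (hpos _ (by simp))] at h1
      rw [hv]; linarith)
  rw [mem_Icc, le_div_iff₀ (hpos v hv), div_le_iff₀ (hpos v hv)]
  constructor <;> linarith

/-- The law of the exit corner of the chain on its way to a long word `y` approaches the harmonic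
coordinates of an infinite word that shares a long prefix with `y`. -/
lemma exists_exit_close (x : InfWord) {ε : ℝ} (hε : 0 < ε) : ∃ m : ℕ, ∀ n, ∀ y : Word,
    y.length = n + 1 → m ≤ n → y.take m = x.pre m → ∀ c,
      |hitProb p hp (rep n c) y / (∑ d, hitProb p hp (rep n d) y) - harmCode x c| < ε := by
  obtain ⟨m₀, hm₀⟩ := exists_pow_lt_of_lt_one (show 0 < ε / 3 by positivity)
    (show (3 / 5 : ℝ) < 1 by norm_num)
  have h1 : ∀ᶠ k in atTop, ∀ c j, |green hp (m₀ + k) c (x.pre m₀ ++ rep (k + 1) j) /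
      greenSum hp (m₀ + k) (x.pre m₀ ++ rep (k + 1) j) -
      harmWord (x.pre m₀) (Pi.single j 1) c| < ε / 3 := by
    rw [eventually_all]
    intro c
    rw [eventually_all]
    intro j
    have := tendsto_green_div hp c (x.pre m₀) j
    rw [Metric.tendsto_nhds] at this
    simpa only [Real.dist_eq, length_pre] using this (ε / 3) (by positivity)
  have h2 : ∀ᶠ k in atTop, dpar p k / dpar p 0 < ε / 3 := by
    have := (tendsto_dpar hp).div_const (dpar p 0)
    rw [zero_div] at this
    exact this.eventually (gt_mem_nhds (by positivity))
  obtain ⟨K, hK⟩ := eventually_atTop.1 (h1.and h2)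
  refine ⟨m₀ + K + 1, fun n y hy hmn htake c => ?_⟩
  have hpre : y.take m₀ = x.pre m₀ := by
    rw [← take_pre x (show m₀ ≤ m₀ + K + 1 by omega), ← htake, List.take_take]
    congr 1; omega
  obtain ⟨k, rfl⟩ : ∃ k, n = m₀ + k := ⟨n - m₀, by omega⟩
  have e : y = x.pre m₀ ++ y.drop m₀ := by rw [← hpre, List.take_append_drop]
  have hg : green hp (m₀ + k) c y / greenSum hp (m₀ + k) y ∈
      Icc (harmCode x c - 2 * (ε / 3)) (harmCode x c + 2 * (ε / 3)) := by
    have := green_div_mem_Icc hp c (w := x.pre m₀) (v := y.drop m₀) (k := k)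
      (by simp [hy]; omega) (lo := harmCode x c - 2 * (ε / 3)) (hi := harmCode x c + 2 * (ε / 3))
      (fun j => by
        have h3 := abs_lt.1 ((hK k (by omega)).1 c j)
        have h4 := abs_le.1
          (abs_harmWord_sub_harmCode_le x m₀ (single_mem_stdSimplex ℝ j) c)
        rw [length_pre, mem_Icc]
        constructor <;> linarith)
    rwa [length_pre, ← e] at this
  have h5 := abs_le.1 ((abs_hitProb_div_sub_le hp (by omega) hy).2 c)
  have h6 := (hK (m₀ + k) (by omega)).2
  rw [abs_lt]
  constructor <;> linarith [hg.1, hg.2]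

/-! ### The Martin kernel -/

/-- The factor by which the chain contracts, between the levels `m` and `N`, the differences of
hitting probabilities from the three corners. -/
def lam (p : ℝ) (m N : ℕ) : ℝ := ∏ i ∈ Finset.Ico m N, (1 - dpar p i / dpar p 0)

lemma dpar_div_le (i : ℕ) : dpar p i / dpar p 0 ≤ (2 / 3) ^ i :=
  (div_le_iff₀ (dpar_pos hp 0)).2 (dpar_le hp i)

lemma dpar_div_mem (i : ℕ) : 0 ≤ dpar p i / dpar p 0 ∧ dpar p i / dpar p 0 ≤ 1 :=
  ⟨(div_pos (dpar_pos hp i) (dpar_pos hp 0)).le,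
    (dpar_div_le hp i).trans (pow_le_one₀ (by norm_num) (by norm_num))⟩

/-- The limit of `lam` as the upper level grows. -/
def lamLim (p : ℝ) (m : ℕ) : ℝ := ⨅ N, lam p m N

lemma lam_nonneg (m N : ℕ) : 0 ≤ lam p m N :=
  Finset.prod_nonneg fun i _ => by linarith [(dpar_div_mem hp i).2]

lemma tendsto_lam (m : ℕ) : Tendsto (lam p m) atTop (𝓝 (lamLim p m)) := by
  refine tendsto_atTop_ciInf (antitone_nat_of_succ_le fun N => ?_)
    ⟨0, by rintro _ ⟨N, rfl⟩; exact lam_nonneg hp m N⟩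
  rcases le_or_gt m N with h | h
  · have h0 := lam_nonneg hp m N
    have := (dpar_div_mem hp N).1
    have e : lam p m (N + 1) = lam p m N * (1 - dpar p N / dpar p 0) := by
      rw [lam, Finset.prod_Ico_succ_top h, lam]
    rw [e]
    nlinarith
  · simp [lam, Finset.Ico_eq_empty_of_le (show N + 1 ≤ m from h),
      Finset.Ico_eq_empty_of_le (show N ≤ m from h.le)]

/-- The differences between the corners do not die out: the product of contraction factors
converges to a positive limit. -/
lemma lamLim_one_pos : 0 < lamLim p 1 := by
  have h1 : ∀ i, 1 ≤ i → Real.exp (-(3 * (2 / 3) ^ i)) ≤ 1 - dpar p i / dpar p 0 := by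
    intro i hi
    have h2 := dpar_div_le hp i
    have h3 : ((2 : ℝ) / 3) ^ i ≤ 2 / 3 :=
      pow_le_of_le_one (by norm_num) (by norm_num) (by omega)
    set q : ℝ := (2 / 3) ^ i
    have h0 : 0 ≤ q := by positivity
    -- `(1 - q) (1 + 3 q) ≥ 1` holds up to `q = 2 / 3`
    have h4 : (1 - q) * Real.exp (3 * q) ≥ 1 := by
      have := Real.add_one_le_exp (3 * q)
      nlinarith
    rw [Real.exp_neg, inv_le_iff_one_le_mul₀ (Real.exp_pos _)]
    exact h4.le.trans (by gcongr)
  have h2 : ∀ N, Real.exp (-9) ≤ lam p 1 N := by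
    intro N
    have h3 : ∑ i ∈ Finset.Ico 1 N, ((2 : ℝ) / 3) ^ i ≤ 3 := by
      have h4 := sum_le_hasSum (f := fun i : ℕ => ((2 : ℝ) / 3) ^ i) (Finset.Ico 1 N)
        (fun i _ => by positivity) (hasSum_geometric_of_lt_one (by norm_num) (by norm_num))
      norm_num at h4 ⊢
      exact h4
    calc Real.exp (-9) ≤ Real.exp (∑ i ∈ Finset.Ico 1 N, -(3 * (2 / 3 : ℝ) ^ i)) := by
          rw [Real.exp_le_exp, Finset.sum_neg_distrib, ← Finset.mul_sum]; linarith
      _ = ∏ i ∈ Finset.Ico 1 N, Real.exp (-(3 * (2 / 3 : ℝ) ^ i)) := Real.exp_sum _ _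
      _ ≤ lam p 1 N := Finset.prod_le_prod (fun _ _ => (Real.exp_pos _).le)
          fun i hi => h1 i (Finset.mem_Ico.1 hi).1
  exact lt_of_lt_of_le (Real.exp_pos (-9)) (le_ciInf h2)

lemma hitProb_rep_step {m : ℕ} (hm : 1 ≤ m) {y : Word} (hy : m + 1 < y.length) (c : Fin 3) :
    hitProb p hp (rep m c) y = (1 - dpar p m / dpar p 0) * hitProb p hp (rep (m + 1) c) y +
      dpar p m / dpar p 0 / 3 * ∑ d, hitProb p hp (rep (m + 1) d) y := by
  have hne : rep m c ≠ y := by rintro rfl; simp at hy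
  have h1 : hitProb p hp (rep m c) y =
      ∑ d, hitProb p hp (rep m c) (rep (m + 1) d) * hitProb p hp (rep (m + 1) d) y := by
    rw [hitProb_corner hp hne, Finset.sum_congr rfl fun k _ =>
      hitProb_decomp hp (m := m) (z := rep m c ++ [k]) (by simp) hy, Finset.sum_comm,
      Finset.mul_sum]
    refine Finset.sum_congr rfl fun d _ => ?_
    rw [hitProb_corner hp (y := rep (m + 1) d)
      (by intro h; simpa using congrArg List.length h), ← Finset.sum_mul, mul_assoc]
  rw [h1]
  simp only [hitProb_rep_succ hp hm, add_mul, ite_mul, zero_mul, Finset.sum_add_distrib,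
    Finset.sum_ite_eq, Finset.mem_univ, if_true, Finset.mul_sum]

lemma sum_hitProb_rep_step {m : ℕ} (hm : 1 ≤ m) {y : Word} (hy : m + 1 < y.length) :
    ∑ c, hitProb p hp (rep m c) y = ∑ c, hitProb p hp (rep (m + 1) c) y := by
  simp only [hitProb_rep_step hp hm hy, Finset.sum_add_distrib, ← Finset.mul_sum,
    Finset.sum_const, Finset.card_univ, Fintype.card_fin]
  simp
  ring

/-- Hitting probabilities from the corners of level `m` in terms of those from level `N`. -/
lemma hitProb_rep_levels {N : ℕ} {y : Word} (hy : y.length = N + 1) (j : ℕ) :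
    ∀ m, 1 ≤ m → m + j = N →
      (∑ c, hitProb p hp (rep m c) y = ∑ c, hitProb p hp (rep N c) y) ∧
      ∀ c, hitProb p hp (rep m c) y = lam p m N * hitProb p hp (rep N c) y +
        (1 - lam p m N) / 3 * ∑ d, hitProb p hp (rep N d) y := by
  induction j with
  | zero =>
    rintro m - rfl
    simp [lam]
  | succ j ih =>
    intro m hm hj
    obtain ⟨h1, h2⟩ := ih (m + 1) (by omega) (by omega)
    refine ⟨(sum_hitProb_rep_step hp hm (by omega)).trans h1, fun c => ?_⟩
    have e : lam p m N = (1 - dpar p m / dpar p 0) * lam p (m + 1) N := by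
      rw [lam, Finset.prod_eq_prod_Ico_succ_bot (by omega), lam]
    rw [hitProb_rep_step hp hm (by omega), h1, h2, e]
    ring

lemma hitProb_nil {N : ℕ} (hN : 1 ≤ N) {y : Word} (hy : y.length = N + 1) :
    hitProb p hp [] y = 1 / 3 * ∑ d, hitProb p hp (rep N d) y := by
  have h1 : hitProb p hp [] y = 1 / 3 * ∑ k, hitProb p hp (rep 1 k) y :=
    hitProb_corner hp (n := 0) (i := 0) (by rintro rfl; simp at hy)
  rw [h1, (hitProb_rep_levels hp hy (N - 1) 1 le_rfl (by omega)).1]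

/-- The limit of `K(z, y)` as the word `y` tends to the infinite word `x`. -/
def kernelLim (z : Word) (x : InfWord) : ℝ :=
  if z = [] then 1 else 3 * ∑ c, hitProb p hp z (rep z.length c) *
    (lamLim p z.length * harmCode x c + (1 - lamLim p z.length) / 3)

lemma martinKernel_eq {z y : Word} (hz : 1 ≤ z.length) {N : ℕ} (hy : y.length = N + 1)
    (hzN : z.length ≤ N) :
    martinKernel p hp z y = 3 * ∑ c, hitProb p hp z (rep z.length c) *
      (lam p z.length N * (hitProb p hp (rep N c) y / ∑ d, hitProb p hp (rep N d) y) +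
        (1 - lam p z.length N) / 3) := by
  have hpos := (abs_hitProb_div_sub_le hp (by omega) hy).1
  obtain ⟨m, hm⟩ := Nat.exists_eq_add_of_le' hz
  rw [martinKernel, hitProb_nil hp (by omega) hy, hm,
    hitProb_decomp hp hm (by omega), Finset.sum_div, Finset.mul_sum _ _ (3 : ℝ)]
  refine Finset.sum_congr rfl fun c _ => ?_
  rw [(hitProb_rep_levels hp hy (N - (m + 1)) (m + 1) (by omega) (by omega)).2 c]
  field_simp

/-- Convergence of the Martin kernel. -/
theorem martinKernel_close (z : Word) (x : InfWord) {ε : ℝ} (hε : 0 < ε) : ∃ m : ℕ, ∀ y : Word,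
    m ≤ y.length → y.take m = x.pre m → |martinKernel p hp z y - kernelLim hp z x| < ε := by
  by_cases hz : z = []
  · subst hz
    refine ⟨2, fun y hy _ => ?_⟩
    obtain ⟨N, hN⟩ : ∃ N, y.length = N + 1 := ⟨y.length - 1, by omega⟩
    have h1 := (abs_hitProb_div_sub_le hp (by omega) hN).1
    rw [martinKernel, div_self, kernelLim, if_pos rfl]
    · simpa using hε
    · rw [hitProb_nil hp (by omega) hN]; positivity
  have hz1 : 1 ≤ z.length := List.length_pos_iff.2 hz
  -- the kernel is a continuous function of the factor `lam` and of the three exit probabilities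
  have hcont : Tendsto (fun q : ℝ × (Fin 3 → ℝ) => 3 * ∑ c : Fin 3,
      hitProb p hp z (rep z.length c) * (q.1 * q.2 c + (1 - q.1) / 3))
      (𝓝 (lamLim p z.length, harmCode x))
      (𝓝 (kernelLim hp z x)) := by
    rw [kernelLim, if_neg hz]
    have hc : Continuous fun q : ℝ × (Fin 3 → ℝ) => 3 * ∑ c : Fin 3,
        hitProb p hp z (rep z.length c) * (q.1 * q.2 c + (1 - q.1) / 3) := by fun_prop
    exact hc.tendsto (lamLim p z.length, harmCode x)
  obtain ⟨δ, hδ, hδ'⟩ := Metric.tendsto_nhds_nhds.1 hcont ε hε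
  obtain ⟨M, hM⟩ := eventually_atTop.1 (Metric.tendsto_nhds.1 (tendsto_lam hp z.length) δ hδ)
  obtain ⟨m, hm⟩ := exists_exit_close hp x hδ
  refine ⟨m + M + z.length + 1, fun y hy htake => ?_⟩
  obtain ⟨N, hN⟩ : ∃ N, y.length = N + 1 := ⟨y.length - 1, by omega⟩
  have htake' : y.take m = x.pre m := by
    rw [← take_pre x (show m ≤ m + M + z.length + 1 by omega), ← htake, List.take_take]
    congr 1; omega
  have h1 := hm N y hN (by omega) htake'
  have h2 := @hδ' (lam p z.length N,
    fun c => hitProb p hp (rep N c) y / ∑ d, hitProb p hp (rep N d) y) (by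
      rw [Prod.dist_eq, max_lt_iff]
      exact ⟨hM N (by omega), (dist_pi_lt_iff hδ).2 fun c => h1 c⟩)
  rw [martinKernel_eq hp hz1 hN (by omega)]
  exact h2

lemma kernelLim_eq_of_glued {x y : InfWord} (h : Glued x y) (z : Word) :
    kernelLim hp z x = kernelLim hp z y := by
  rw [kernelLim, kernelLim, (harmCode_eq_iff x y).2 h]

lemma exists_kernelLim_ne {x y : InfWord} (h : ¬ Glued x y) :
    ∃ i : Fin 3, kernelLim hp [i] x ≠ kernelLim hp [i] y := by
  obtain ⟨i, hi⟩ : ∃ i, harmCode x i ≠ harmCode y i := by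
    by_contra! h'
    exact h ((harmCode_eq_iff x y).1 (funext h'))
  refine ⟨i, fun h' => hi ?_⟩
  have e : ∀ x, kernelLim hp [i] x = 3 * (lamLim p 1 * harmCode x i + (1 - lamLim p 1) / 3) := by
    intro x
    have h1 : ∀ c, hitProb p hp [i] (rep 1 c) = if i = c then 1 else 0 :=
      fun c => hitProb_rep_rep hp (n := 0) i c
    simp only [kernelLim, if_neg (List.cons_ne_nil i []), List.length_singleton, h1]
    simp
  rw [e, e] at h'
  have := lamLim_one_pos hp
  exact mul_left_cancel₀ this.ne' (by linarith)

end

/-! ### The Martin metric -/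

section

section Estimates

variable {p : ℝ} (hp : p ∈ Ioo (0 : ℝ) (1 / 2))

lemma inv_martinConst (z : Word) : (martinConst p hp z)⁻¹ = hitProb p hp [] z := by
  rw [martinConst, one_div, inv_inv]

lemma martinKernel_nonneg (z y : Word) : 0 ≤ martinKernel p hp z y :=
  div_nonneg (hitProb_nonneg hp _ _) (hitProb_nonneg hp _ _)

lemma inv_martinConst_mul_le (z y : Word) :
    (martinConst p hp z)⁻¹ * martinKernel p hp z y ≤ 1 := by
  rw [inv_martinConst, martinKernel, ← mul_div_assoc]
  exact div_le_one_of_le₀ (hitProb_mul_le hp _ _ _) (hitProb_nonneg hp _ _)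

lemma martin_term_le_one (z y y' : Word) :
    (martinConst p hp z)⁻¹ * |martinKernel p hp z y - martinKernel p hp z y'| ≤ 1 := by
  have h0 : 0 ≤ (martinConst p hp z)⁻¹ := by rw [inv_martinConst]; exact hitProb_nonneg hp _ _
  have h1 := inv_martinConst_mul_le hp z y
  have h2 := inv_martinConst_mul_le hp z y'
  have h3 := mul_nonneg h0 (martinKernel_nonneg hp z y)
  have h4 := mul_nonneg h0 (martinKernel_nonneg hp z y')
  rw [show (martinConst p hp z)⁻¹ * |martinKernel p hp z y - martinKernel p hp z y'| =
    |(martinConst p hp z)⁻¹ * martinKernel p hp z y -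
      (martinConst p hp z)⁻¹ * martinKernel p hp z y'| by
      rw [← mul_sub, abs_mul, abs_of_nonneg h0], abs_le]
  constructor <;> linarith

variable {r : ℝ} (hr : r ∈ Ioo (0 : ℝ) 1)
include hr

lemma tsum_ofReal_pow_ne_top : ∑' n : ℕ, ENNReal.ofReal (r ^ n) ≠ ⊤ := by
  rw [← ENNReal.ofReal_tsum_of_nonneg (fun n => pow_nonneg hr.1.le n)
    (summable_geometric_of_lt_one hr.1.le hr.2)]
  exact ENNReal.ofReal_ne_top

omit hr in
lemma martin_sup_le_one (n : ℕ) (y y' : Word) :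
    ENNReal.ofReal (r ^ n) * ⨆ (z : Word) (_ : z.length = n),
      ENNReal.ofReal ((martinConst p hp z)⁻¹ * |martinKernel p hp z y - martinKernel p hp z y'|) ≤
      ENNReal.ofReal (r ^ n) := by
  refine mul_le_of_le_one_right' (iSup₂_le fun z _ => ?_)
  rw [← ENNReal.ofReal_one]
  exact ENNReal.ofReal_le_ofReal (martin_term_le_one hp z y y')

lemma martinDist_ne_top (y y' : Word) : martinDist p hp r y y' ≠ ⊤ := by
  refine ENNReal.add_ne_top.2 ⟨ENNReal.ofReal_ne_top, ?_⟩
  exact ne_top_of_le_ne_top (tsum_ofReal_pow_ne_top hr)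
    (ENNReal.tsum_le_tsum fun n => martin_sup_le_one hp n y y')

/-- Long words whose prefixes come from infinite words with the same limits of Martin kernels
are close to each other. -/
lemma martinDist_close {x x' : InfWord} (h : ∀ z, kernelLim hp z x = kernelLim hp z x') {ε : ℝ}
    (hε : 0 < ε) : ∃ m : ℕ, ∀ y y' : Word, m ≤ y.length → m ≤ y'.length → y.take m = x.pre m →
      y'.take m = x'.pre m → martinDist p hp r y y' ≤ ENNReal.ofReal ε := by
  have hε3 : 0 < ε / 3 := by positivity
  -- the words `z` of length at least `N` contribute at most `ε / 3`, whatever the two words are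
  obtain ⟨N, hN⟩ := ((ENNReal.tendsto_sum_nat_add _ (tsum_ofReal_pow_ne_top hr)).eventually
    (gt_mem_nhds (ENNReal.ofReal_pos.2 hε3))).exists
  obtain ⟨M, hM⟩ := exists_pow_lt_of_lt_one hε3 hr.2
  set η : ℝ := ε / 3 / (N + 1) with hη
  have hη0 : 0 < η := by positivity
  have cut : ∀ (a b : ℕ) (y : Word) (x : InfWord), a ≤ b → y.take b = x.pre b →
      y.take a = x.pre a := by
    intro a b y x hab hy
    rw [← take_pre x hab, ← hy, List.take_take, min_eq_left hab]
  have hz : ∀ z : Word, ∃ m : ℕ, ∀ y y' : Word, m ≤ y.length → m ≤ y'.length →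
      y.take m = x.pre m → y'.take m = x'.pre m →
      |martinKernel p hp z y - martinKernel p hp z y'| ≤ η := by
    intro z
    obtain ⟨m, hm⟩ := martinKernel_close hp z x (half_pos hη0)
    obtain ⟨m', hm'⟩ := martinKernel_close hp z x' (half_pos hη0)
    refine ⟨max m m', fun y y' hy hy' ht ht' => ?_⟩
    have h1 := abs_lt.1 (hm y (le_of_max_le_left hy) (cut _ _ _ _ (le_max_left _ _) ht))
    have h2 := abs_lt.1 (hm' y' (le_of_max_le_right hy') (cut _ _ _ _ (le_max_right _ _) ht'))
    rw [← h z] at h2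
    rw [abs_le]
    constructor <;> linarith
  choose mz hmz using hz
  set B : ℕ := ((Finset.range N).biUnion wordsOf).sup mz with hB
  refine ⟨max M B, fun y y' hy hy' ht ht' => ?_⟩
  have hfirst : ENNReal.ofReal |r ^ y.length - r ^ y'.length| ≤ ENNReal.ofReal (ε / 3) := by
    refine ENNReal.ofReal_le_ofReal ?_
    have h1 : ∀ k, M ≤ k → 0 ≤ r ^ k ∧ r ^ k ≤ ε / 3 := fun k hk =>
      ⟨pow_nonneg hr.1.le k, (pow_le_pow_of_le_one hr.1.le hr.2.le hk).trans hM.le⟩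
    have h2 := h1 _ (le_of_max_le_left hy)
    have h3 := h1 _ (le_of_max_le_left hy')
    rw [abs_le]
    constructor <;> linarith
  have hsmall : ∀ n ∈ Finset.range N,
      ENNReal.ofReal (r ^ n) * ⨆ (z : Word) (_ : z.length = n), ENNReal.ofReal
        ((martinConst p hp z)⁻¹ * |martinKernel p hp z y - martinKernel p hp z y'|) ≤
      ENNReal.ofReal η := by
    intro n hn
    refine (mul_le_of_le_one_left' (ENNReal.ofReal_le_one.2 (pow_le_one₀ hr.1.le hr.2.le))).trans
      (iSup₂_le fun z hz => ENNReal.ofReal_le_ofReal ?_)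
    have hzB : mz z ≤ max M B :=
      (Finset.le_sup (f := mz) (Finset.mem_biUnion.2 ⟨n, hn, mem_wordsOf.2 hz⟩)).trans
        (le_max_right _ _)
    have h1 := hmz z y y' (hzB.trans hy) (hzB.trans hy') (cut _ _ _ _ hzB ht) (cut _ _ _ _ hzB ht')
    rw [inv_martinConst]
    exact (mul_le_of_le_one_left (abs_nonneg _) (hitProb_le_one hp _ _)).trans h1
  rw [martinDist, ← Summable.sum_add_tsum_nat_add' (k := N) ENNReal.summable]
  have h2 : (N : ℝ≥0∞) * ENNReal.ofReal η ≤ ENNReal.ofReal (ε / 3) := by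
    rw [← ENNReal.ofReal_natCast, ← ENNReal.ofReal_mul (Nat.cast_nonneg N)]
    refine ENNReal.ofReal_le_ofReal ?_
    rw [hη, mul_div_assoc', div_le_iff₀ (by positivity)]
    nlinarith
  calc _ ≤ ENNReal.ofReal (ε / 3) + (ENNReal.ofReal (ε / 3) + ENNReal.ofReal (ε / 3)) := by
        refine add_le_add hfirst (add_le_add ?_ ?_)
        · refine (Finset.sum_le_sum hsmall).trans ?_
          simpa using h2
        · exact (ENNReal.tsum_le_tsum fun n => martin_sup_le_one hp (n + N) y y').trans hN.le
    _ = ENNReal.ofReal ε := by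
        rw [← ENNReal.ofReal_add hε3.le hε3.le, ← ENNReal.ofReal_add hε3.le (by positivity)]
        congr 1; ring

end Estimates

/-! ### The Martin boundary -/

section Boundary

variable {p r : ℝ} (hp : p ∈ Ioo (0 : ℝ) (1 / 2)) (hr : r ∈ Ioo (0 : ℝ) 1)

/-- The Martin metric is finite, hence a pseudometric with real values; the uniform structure stays
the one that the completion is taken for. -/
abbrev martinWordMetric : PseudoMetricSpace (MartinWord p hp r) :=
  PseudoEMetricSpace.toPseudoMetricSpace fun y y' => martinDist_ne_top hp hr y y'

/-- The Martin space as a metric space. -/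
abbrev martinSpaceMetric : MetricSpace (MartinSpace p hp r) :=
  letI := martinWordMetric hp hr
  UniformSpace.Completion.instMetricSpace

lemma edist_toMartin (y y' : Word) :
    letI := martinSpaceMetric hp hr
    edist (toMartin p hp r y) (toMartin p hp r y') = martinDist p hp r y y' := by
  let _ := martinWordMetric hp hr
  exact UniformSpace.Completion.edist_eq (α := MartinWord p hp r) y y'

include hr in
lemma exists_martin_limit (x : InfWord) :
    ∃ ξ : MartinSpace p hp r, Tendsto (fun n => toMartin p hp r (x.pre n)) atTop (𝓝 ξ) := by
  let _ := martinSpaceMetric hp hr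
  refine cauchySeq_tendsto_of_complete (Metric.cauchySeq_iff.2 fun ε hε => ?_)
  obtain ⟨m, hm⟩ := martinDist_close hp hr (x := x) (x' := x) (fun _ => rfl) (half_pos hε)
  refine ⟨m, fun a ha b hb => ?_⟩
  have h := hm (x.pre a) (x.pre b) (by simpa [length_pre]) (by simpa [length_pre])
    (take_pre x ha) (take_pre x hb)
  rw [← edist_toMartin hp hr, edist_dist, ENNReal.ofReal_le_ofReal_iff (by positivity)] at h
  linarith

/-- The limit in the Martin space of the prefixes of an infinite word. -/
def martinLim (x : InfWord) : MartinSpace p hp r := (exists_martin_limit hp hr x).choose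

lemma tendsto_martinLim (x : InfWord) :
    Tendsto (fun n => toMartin p hp r (x.pre n)) atTop (𝓝 (martinLim hp hr x)) :=
  (exists_martin_limit hp hr x).choose_spec

lemma tendsto_martinDist (x x' : InfWord) :
    letI := martinSpaceMetric hp hr
    Tendsto (fun n => martinDist p hp r (x.pre n) (x'.pre n)) atTop
      (𝓝 (edist (martinLim hp hr x) (martinLim hp hr x'))) := by
  let _ := martinSpaceMetric hp hr
  simp only [← edist_toMartin hp hr]
  exact (tendsto_martinLim hp hr x).edist (tendsto_martinLim hp hr x')

lemma martinLim_eq_of_glued {x x' : InfWord} (h : Glued x x') :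
    martinLim hp hr x = martinLim hp hr x' := by
  let _ := martinSpaceMetric hp hr
  refine edist_le_zero.1 (ENNReal.le_of_forall_pos_le_add fun ε hε _ => ?_)
  rw [zero_add]
  obtain ⟨m, hm⟩ := martinDist_close hp hr (kernelLim_eq_of_glued hp h)
    (show (0 : ℝ) < ε from hε)
  refine le_of_tendsto (tendsto_martinDist hp hr x x') (eventually_atTop.2 ⟨m, fun n hn => ?_⟩)
  simpa using hm (x.pre n) (x'.pre n) (by simpa [length_pre]) (by simpa [length_pre])
    (take_pre x hn) (take_pre x' hn)

lemma continuous_martinLim : Continuous (martinLim hp hr) := by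
  let _ := martinSpaceMetric hp hr
  rw [continuous_iff_continuousAt]
  intro x
  rw [ContinuousAt, Metric.tendsto_nhds]
  intro ε hε
  obtain ⟨m, hm⟩ := martinDist_close hp hr (x := x) (x' := x) (fun _ => rfl) (half_pos hε)
  filter_upwards [eventually_pre_eq x m] with y hy
  have h : edist (martinLim hp hr y) (martinLim hp hr x) ≤ ENNReal.ofReal (ε / 2) := by
    refine le_of_tendsto (tendsto_martinDist hp hr y x) (eventually_atTop.2 ⟨m, fun n hn => ?_⟩)
    exact hm (y.pre n) (x.pre n) (by simpa [length_pre]) (by simpa [length_pre])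
      ((take_pre y hn).trans hy) (take_pre x hn)
  rw [edist_dist, ENNReal.ofReal_le_ofReal_iff (by positivity)] at h
  linarith

lemma hitProb_nil_singleton_pos (i : Fin 3) : 0 < hitProb p hp [] [i] := by
  have h1 : hitProb p hp [] [i] = 1 / 3 * ∑ k, hitProb p hp [k] [i] :=
    hitProb_corner hp (n := 0) (i := 0) (y := [i]) (by simp)
  have h2 : hitProb p hp [i] [i] ≤ ∑ k, hitProb p hp [k] [i] :=
    Finset.single_le_sum (f := fun k => hitProb p hp [k] [i])
      (fun k _ => hitProb_nonneg hp _ _) (Finset.mem_univ i)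
  rw [hitProb_self] at h2
  rw [h1]
  linarith

lemma tendsto_martinKernel (z : Word) (x : InfWord) :
    Tendsto (fun n => martinKernel p hp z (x.pre n)) atTop (𝓝 (kernelLim hp z x)) := by
  rw [Metric.tendsto_atTop]
  intro ε hε
  obtain ⟨m, hm⟩ := martinKernel_close hp z x hε
  exact ⟨m, fun n hn => hm _ (by simpa [length_pre]) (take_pre x hn)⟩

/-- Different points of the gasket are separated already by the kernels at the words of length
one. -/
lemma martinLim_ne {x x' : InfWord} (h : ¬ Glued x x') :
    martinLim hp hr x ≠ martinLim hp hr x' := by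
  let _ := martinSpaceMetric hp hr
  obtain ⟨i, hi⟩ := exists_kernelLim_ne hp h
  intro heq
  have h1 := tendsto_martinDist hp hr x x'
  rw [heq, edist_self] at h1
  have h2 : Tendsto (fun n => ENNReal.ofReal (r ^ 1) * ENNReal.ofReal
      (hitProb p hp [] [i] * |martinKernel p hp [i] (x.pre n) - martinKernel p hp [i] (x'.pre n)|))
      atTop (𝓝 (ENNReal.ofReal (r ^ 1) * ENNReal.ofReal
        (hitProb p hp [] [i] * |kernelLim hp [i] x - kernelLim hp [i] x'|))) := by
    refine ENNReal.Tendsto.const_mul (ENNReal.tendsto_ofReal ?_) (Or.inr ENNReal.ofReal_ne_top)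
    exact (((tendsto_martinKernel hp [i] x).sub (tendsto_martinKernel hp [i] x')).abs).const_mul _
  have h3 := le_of_tendsto_of_tendsto' h2 h1 fun n => by
    rw [martinDist, ← inv_martinConst]
    refine le_trans ?_ le_add_self
    refine le_trans ?_ (ENNReal.le_tsum 1)
    gcongr
    exact le_iSup₂_of_le [i] rfl le_rfl
  have h4 := hitProb_nil_singleton_pos hp i
  have h5 : 0 < |kernelLim hp [i] x - kernelLim hp [i] x'| := abs_pos.2 (sub_ne_zero.2 hi)
  refine absurd h3 (not_le.2 (ENNReal.mul_pos ?_ ?_))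
  · exact (ENNReal.ofReal_pos.2 (pow_pos hr.1 1)).ne'
  · exact (ENNReal.ofReal_pos.2 (mul_pos h4 h5)).ne'

lemma martinLim_eq_iff (x x' : InfWord) :
    martinLim hp hr x = martinLim hp hr x' ↔ proj x = proj x' := by
  rw [proj_eq_iff]
  exact ⟨fun h => by_contra fun h' => martinLim_ne hp hr h' h, martinLim_eq_of_glued hp hr⟩

/-- The first term of the Martin metric keeps limits of prefixes away from the finite words. -/
lemma martinLim_mem (x : InfWord) : martinLim hp hr x ∈ martinBoundary p hp r := by
  let _ := martinSpaceMetric hp hr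
  rintro ⟨w, hw⟩
  have h1 : Tendsto (fun n => edist (toMartin p hp r w) (toMartin p hp r (x.pre n))) atTop
      (𝓝 0) := by
    rw [← edist_self (martinLim hp hr x), hw]
    exact tendsto_const_nhds.edist (tendsto_martinLim hp hr x)
  have h2 : Tendsto (fun n => ENNReal.ofReal |r ^ w.length - r ^ n|) atTop
      (𝓝 (ENNReal.ofReal |r ^ w.length - 0|)) :=
    ENNReal.tendsto_ofReal
      ((tendsto_pow_atTop_nhds_zero_of_lt_one hr.1.le hr.2).const_sub _).abs
  have h3 := le_of_tendsto_of_tendsto' h2 h1 fun n => by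
    rw [edist_toMartin hp hr, martinDist, length_pre]
    exact le_self_add
  have h4 : 0 < r ^ w.length := pow_pos hr.1 _
  rw [sub_zero, abs_of_pos h4] at h3
  exact absurd h3 (not_le.2 (ENNReal.ofReal_pos.2 h4))

/-- Every point of the boundary is a limit of prefixes: finite words whose lengths tend to
infinity have, along an ultrafilter, prefixes that stabilize. -/
lemma exists_martinLim_eq {ξ : MartinSpace p hp r} (hξ : ξ ∈ martinBoundary p hp r) :
    ∃ x, martinLim hp hr x = ξ := by
  let _ := martinSpaceMetric hp hr
  have hdense : DenseRange (toMartin p hp r) :=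
    UniformSpace.Completion.denseRange_coe (α := MartinWord p hp r)
  have : NeBot (comap (toMartin p hp r) (𝓝 ξ)) := by
    refine comap_neBot fun t ht => ?_
    obtain ⟨_, h1, w, rfl⟩ := mem_closure_iff_nhds.1 (hdense ξ) t ht
    exact ⟨w, h1⟩
  set U : Ultrafilter Word := Ultrafilter.of (comap (toMartin p hp r) (𝓝 ξ)) with hU
  have hlim : Tendsto (toMartin p hp r) U (𝓝 ξ) :=
    tendsto_comap.mono_left (Ultrafilter.of_le _)
  have hlen : ∀ n, ∀ᶠ w in (U : Filter Word), n ≤ w.length := by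
    intro n
    by_contra hn
    have hn' : ∀ᶠ w in (U : Filter Word), w ∈ ((Finset.range n).biUnion wordsOf : Set Word) := by
      filter_upwards [Ultrafilter.eventually_not.2 hn] with w hw
      simpa using hw
    obtain ⟨w, -, hw⟩ := Ultrafilter.eq_pure_of_finite_mem (Finset.finite_toSet _) hn'
    refine hξ ⟨w, ?_⟩
    rw [hw] at hlim
    exact tendsto_nhds_unique (tendsto_pure_nhds _ _) hlim
  let ext : Word → InfWord := fun w n => w.getD n 0
  obtain ⟨x, -, hx⟩ := isCompact_univ.ultrafilter_le_nhds (U.map ext) (by simp)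
  refine ⟨x, ?_⟩
  have htake : ∀ m, ∀ᶠ w in (U : Filter Word), w.take m = x.pre m := by
    intro m
    have h1 : ∀ᶠ w in (U : Filter Word), (ext w).pre m = x.pre m := hx (eventually_pre_eq x m)
    filter_upwards [h1, hlen m] with w hw hl
    rw [← hw]
    refine List.ext_getElem (by simp [length_pre, hl]) fun k hk _ => ?_
    have hk' : k < w.length := by simp at hk; omega
    simp [InfWord.pre, ext, hk']
  refine dist_le_zero.1 (le_of_forall_pos_le_add fun ε hε => ?_)
  rw [zero_add]
  obtain ⟨m, hm⟩ := martinDist_close hp hr (x := x) (x' := x) (fun _ => rfl) hε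
  refine le_of_tendsto ((tendsto_const_nhds (x := martinLim hp hr x)).dist hlim) ?_
  filter_upwards [hlen m, htake m] with w hw hw'
  refine le_of_tendsto ((tendsto_martinLim hp hr x).dist tendsto_const_nhds)
    (eventually_atTop.2 ⟨m, fun n hn => ?_⟩)
  have h := hm (x.pre n) w (by simpa [length_pre]) hw (take_pre x hn) hw'
  rwa [← edist_toMartin hp hr, edist_dist, ENNReal.ofReal_le_ofReal_iff hε.le] at h

/-- The map from `π`-classes of infinite words to the Martin boundary. -/
def boundaryMap : Quotient piSetoid → martinBoundary p hp r :=
  Quotient.lift (fun x => ⟨martinLim hp hr x, martinLim_mem hp hr x⟩) fun x x' h =>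
    Subtype.ext ((martinLim_eq_iff hp hr x x').2 h)

lemma bijective_boundaryMap : Function.Bijective (boundaryMap hp hr) := by
  constructor
  · rintro ⟨x⟩ ⟨x'⟩ h
    exact Quotient.sound ((martinLim_eq_iff hp hr x x').1 (congrArg Subtype.val h))
  · rintro ⟨ξ, hξ⟩
    obtain ⟨x, hx⟩ := exists_martinLim_eq hp hr hξ
    exact ⟨Quotient.mk _ x, Subtype.ext hx⟩

lemma continuous_boundaryMap : Continuous (boundaryMap hp hr) :=
  ((continuous_martinLim hp hr).subtype_mk _).quotient_lift _

/-- The quotient of the infinite words is homeomorphic to the Martin boundary. -/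
def boundaryHomeo : Quotient piSetoid ≃ₜ martinBoundary p hp r :=
  (show Continuous (Equiv.ofBijective _ (bijective_boundaryMap hp hr)) from
    continuous_boundaryMap hp hr).homeoOfEquivCompactToT2

end Boundary

/-- The map from `π`-classes of infinite words to the gasket. -/
def gasketMap : Quotient piSetoid → gasket :=
  Quotient.lift (fun x => ⟨proj x, range_proj ▸ mem_range_self x⟩) fun _ _ h => Subtype.ext h

lemma bijective_gasketMap : Function.Bijective gasketMap := by
  constructor
  · rintro ⟨x⟩ ⟨x'⟩ h
    exact Quotient.sound (congrArg Subtype.val h : proj x = proj x')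
  · rintro ⟨q, hq⟩
    obtain ⟨x, hx⟩ := range_proj.symm ▸ hq
    exact ⟨Quotient.mk _ x, Subtype.ext hx⟩

/-- The quotient of the infinite words is homeomorphic to the gasket. -/
def gasketHomeo : Quotient piSetoid ≃ₜ gasket :=
  (show Continuous (Equiv.ofBijective _ bijective_gasketMap) from
    (continuous_proj.subtype_mk _).quotient_lift _).homeoOfEquivCompactToT2

lemma coe_gasketHomeo_mk (x : InfWord) :
    (gasketHomeo (Quotient.mk piSetoid x) : Plane) = proj x := rfl

end

end

end MartinSG

theorem theorem3p5 (p r : ℝ) (hp : p ∈ Ioo (0 : ℝ) (1 / 2)) (hr : r ∈ Ioo (0 : ℝ) 1) :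
    -- the Martin metric extends to a metric on the quotient of the infinite words
    ∃ ϱ : MetricSpace (Quotient piSetoid),
      (∀ x y : InfWord, Tendsto (fun n => martinDist p hp r (x.pre n) (y.pre n)) atTop
        (𝓝 (ENNReal.ofReal (ϱ.dist (Quotient.mk piSetoid x) (Quotient.mk piSetoid y))))) ∧
      -- which induces the quotient topology
      ϱ.toUniformSpace.toTopologicalSpace =
        (instTopologicalSpaceQuotient : TopologicalSpace (Quotient piSetoid)) ∧
      -- and the quotient, the Martin boundary and the gasket are homeomorphic
      ∃ (Ψ : Quotient piSetoid ≃ₜ martinBoundary p hp r) (Φ : martinBoundary p hp r ≃ₜ gasket),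
        ∀ x : InfWord,
          Tendsto (fun n => toMartin p hp r (x.pre n)) atTop
            (𝓝 (Ψ (Quotient.mk piSetoid x) : MartinSpace p hp r)) ∧
          (Φ (Ψ (Quotient.mk piSetoid x)) : Plane) = proj x := by
  let _ := martinSpaceMetric hp hr
  have hinj : Function.Injective fun q => (boundaryHomeo hp hr q : MartinSpace p hp r) :=
    Subtype.val_injective.comp (boundaryHomeo hp hr).injective
  refine ⟨MetricSpace.induced _ hinj inferInstance, fun x y => ?_, ?_, boundaryHomeo hp hr,
    (boundaryHomeo hp hr).symm.trans gasketHomeo, fun x => ⟨?_, ?_⟩⟩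
  · have h := tendsto_martinDist hp hr x y
    rwa [edist_dist] at h
  · exact (Topology.IsEmbedding.subtypeVal.comp
      (boundaryHomeo hp hr).isEmbedding).eq_induced.symm
  · exact tendsto_martinLim hp hr x
  · simp [coe_gasketHomeo_mk]
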